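/- Let $\Omega=[0,2\pi]^2$ with periodic boundary conditions, let $\hat f(k)=(2\pi)^{-2}\int_\Omega f(x)e^{-ik\cdot x}\,dx$ for $k\in\mathbb Z^2$, let $\Lambda=(-\Delta)^{1/2}$ and $R_j=\partial_j\Lambda^{-1}$ (Fourier symbols $|k|$ and $ik_j/|k|$), and for $r>\tfrac32$, $\beta>0$ put $$\|f\|_{\beta}=\|\Lambda^re^{\beta\Lambda}f\|_{L^2(\Omega)}=2\pi\Big(\sum_{k}|k|^{2r}e^{2\beta|k|}|\hat f(k)|^2\Big)^{1/2},\qquad C_W(r)=\frac1{2\pi}\,\frac{2r-2}{2r-3}.$$ Given $\eta_0$ and a punctured disc $\mathcal R$ centred at $0$, a solution in $\mathcal R$ of the complexified inviscid surface quasi-geostrophic equation $$\frac{d\eta}{d\zeta}+\mathbf u\cdot\nabla\eta=0,\qquad \mathbf u=[-R_2\eta,R_1\eta]^T,\qquad \eta(0)=\eta_0,$$ is a function $\eta$ from $\mathcal R\cup\{0\}$ to the complex mean-zero functions in $L^2(\Omega)$ which is complex differentiable on $\mathcal R$ as an $L^2(\Omega)$-valued function, has $\nabla\eta(\zeta)\in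 L^2(\Omega)$ and satisfies the equation a.e. in $\Omega$ for every $\zeta\in\mathcal R$, and satisfies $\eta(0)=\eta_0$ and $\eta(\zeta)\to\eta_0$ in $L^2(\Omega)$ as $\zeta\to0$. **Theorem 4.1.** There is an absolute constant $C>0$ such that the following holds for all $r>\tfrac32$ and $\beta_0>0$. Let $\eta_0\in L^2(\Omega)$ be a (real- or complex-valued) function of mean zero with $\|\eta_0\|_{\beta_0}<\infty$. Then the complexified inviscid SQG equation with initial value $\eta_0$ has a unique solution $\eta$ in the region $$\mathcal R=\Big\{\zeta=se^{i\theta}:\ \theta\in[0,2\pi),\ 0<s<\frac{C\beta_0}{2^rC_W(r)\|\eta_0\|_{\beta_0}}\Big\}$$ (the whole punctured plane if $\eta_0=0$). Moreover $\eta$ is holomorphic with values in a Gevrey class: each point $\zeta_0$ of $\mathcal R\cup\{0\}$ has a neighbourhood on which, for some $\beta>0$, $\zeta\mapsto\Lambda^re^{\beta\Lambda}\eta(\zeta)$ is a holomorphic $L^2(\Omega)$-valued function. -/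

import Mathlib

open MeasureTheory Filter Topology

namespace SQG

noncomputable section

/-- The spatial domain `[0, 2π]²` (one period cell). -/
def Omega : Set (Fin 2 → ℝ) := Set.Icc 0 (fun _ => 2 * Real.pi)

/-- The complexified space `L²(Ω)`, with respect to Lebesgue measure on the period cell. -/
abbrev L2 : Type := Lp ℂ 2 (volume.restrict Omega)

/-- The Fourier coefficient `(2π)⁻² ∫_Ω f(x) e^{-i k·x} dx`. -/
def coeff (f : L2) (k : Fin 2 → ℤ) : ℂ :=
  (1 / (2 * Real.pi : ℂ) ^ 2) *
    ∫ x in Omega, f x * Complex.exp (-Complex.I * ((∑ j, (k j : ℝ) * x j : ℝ) : ℂ))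

/-- The Euclidean length of a wave vector. -/
def len (k : Fin 2 → ℤ) : ℝ := Real.sqrt (∑ j, (k j : ℝ) ^ 2)

/-- The spatial mean over the period cell vanishes. -/
def MeanZero (f : L2) : Prop := ∫ x in Omega, f x = 0

/-- `f` lies in the domain of the Fourier multiplier with symbol `m`, and `g` is its image.
(An element of `L²(Ω)` is determined by its Fourier coefficients, so there is at most one `g`.) -/
def IsMultiplierImage (m : (Fin 2 → ℤ) → ℂ) (f g : L2) : Prop :=
  ∀ k, coeff g k = m k * coeff f k

/-- The symbol `i k_j` of the (distributional, periodic) partial derivative `∂_j`. -/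
def partialSymbol (j : Fin 2) (k : Fin 2 → ℤ) : ℂ := Complex.I * (k j : ℂ)

/-- The symbol `i k_j / |k|` of the Riesz transform `R_j = ∂_j Λ⁻¹`, `Λ = (-Δ)^{1/2}`.
At `k = 0` its value is `0`; it is only applied to functions of mean zero. -/
def rieszSymbol (j : Fin 2) (k : Fin 2 → ℤ) : ℂ := Complex.I * (k j : ℂ) / (len k : ℂ)

/-- The symbol `|k|^r e^{β|k|}` of `Λ^r e^{βΛ}`. -/
def gevreySymbol (r β : ℝ) (k : Fin 2 → ℤ) : ℝ := len k ^ r * Real.exp (β * len k)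

/-- `g = ∇f`, with both components in `L²(Ω)`. -/
def IsGradient (f : L2) (g : Fin 2 → L2) : Prop :=
  ∀ j, IsMultiplierImage (partialSymbol j) f (g j)

/-- `u = [-R₂ f, R₁ f]ᵀ`. -/
def IsVelocity (f : L2) (u : Fin 2 → L2) : Prop :=
  IsMultiplierImage (fun k => -rieszSymbol 1 k) f (u 0) ∧
    IsMultiplierImage (rieszSymbol 0) f (u 1)

/-- The Gevrey norm `‖Λ^r e^{βΛ} f‖_{L²(Ω)} = (2π) (∑_k |k|^{2r} e^{2β|k|} |f̂(k)|²)^{1/2}`,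
with the value `∞` where the series diverges. -/
def gevreyNorm (r β : ℝ) (f : L2) : ENNReal :=
  ENNReal.ofReal (2 * Real.pi) *
    (∑' k : Fin 2 → ℤ, ENNReal.ofReal ((gevreySymbol r β k * ‖coeff f k‖) ^ 2)) ^
      (1 / 2 : ℝ)

/-- The constant `C_W(r) = (1 / (π 2^{d-1})) (2r - d) / (2r - 1 - d)` in dimension `d = 2`. -/
def wienerConst (r : ℝ) : ℝ := 1 / (2 * Real.pi) * ((2 * r - 2) / (2 * r - 3))

/-- The punctured disc `0 < |ζ| < C β₀ / (2^r C_W(r) M)`, written without division so that it is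
the whole punctured plane when `M = 0`. -/
def region (C r β₀ M : ℝ) : Set ℂ :=
  {ζ | ζ ≠ 0 ∧ 2 ^ r * wienerConst r * M * ‖ζ‖ < C * β₀}

/-- `η` solves the complexified inviscid SQG equation `dη/dζ + u·∇η = 0`, `η(0) = η₀` on `R`:
it is a complex differentiable function from `R` to the mean zero functions in `L²(Ω)`, with
spatial gradient in `L²(Ω)`, the equation holds almost everywhere in `Ω` at every `ζ ∈ R`, and
the initial value is attained continuously in `L²(Ω)`. -/
structure IsSolution (η₀ : L2) (R : Set ℂ) (η : ℂ → L2) : Prop where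
  initial : η 0 = η₀
  attained : Tendsto η (𝓝[R] 0) (𝓝 η₀)
  meanZero : ∀ ζ ∈ R, MeanZero (η ζ)
  equation : ∀ ζ ∈ R, ∃ (D : L2) (u g : Fin 2 → L2),
    HasDerivAt η D ζ ∧ IsVelocity (η ζ) u ∧ IsGradient (η ζ) g ∧
      ∀ᵐ x ∂(volume.restrict Omega), D x + ∑ j, u j x * g j x = 0

/-- `η` is holomorphic at `ζ₀` with values in a Gevrey class: for some `β > 0`, the function
`ζ ↦ Λ^r e^{βΛ} η(ζ)` is defined near `ζ₀` and is holomorphic at `ζ₀` as an `L²(Ω)`-valued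
function. -/
def GevreyHolomorphicAt (r : ℝ) (η : ℂ → L2) (ζ₀ : ℂ) : Prop :=
  ∃ β : ℝ, 0 < β ∧ ∃ w : ℂ → L2, AnalyticAt ℂ w ζ₀ ∧
    ∀ᶠ ζ in 𝓝 ζ₀, IsMultiplierImage (fun k => (gevreySymbol r β k : ℂ)) (η ζ) (w ζ)

end

end SQG

namespace SQG

noncomputable section

open scoped ENNReal

/-! In Fourier variables the term u·∇η is a quadratic convolution Q with kernel `interaction`. A
solution holomorphic near 0 must therefore be the power series in ζ determined by (n+1) η_{n+1} =
-∑_{i+j=n} Q(η_i, η_j), and both existence and uniqueness are read off from this recurrence.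

Existence is a Cauchy–Kovalevskaya estimate in the norms ∑ e^{β|k|}|a_k|. The kernel at (k, h) is at
most |h|, so Q(a, b) loses one derivative, on b only. That loss is paid for by widening β to β + δ,
at the price 1/(eδ). With δ tuned to the index j of b, the price is a factor j + 1 ≤ n + 1, which
the 1/(n+1) of the recurrence absorbs. What remains is the Catalan recursion
(`wienerNorm_taylorCoeff_le_catalan`). Since `catalan n` ≤ 4^n, the series converges for 4M|ζ| < β₀
- β, even after applying a Fourier multiplier of size e^{β|k|}. Gradient, velocity and Gevrey
regularity all come from this.

For uniqueness, a solution is holomorphic off 0 and continuous at 0, so the singularity is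
removable. The kernel is also at most |k|, so each Fourier coefficient of Q is a bounded bilinear
form on L², and power series can be compared with no further regularity (`eq_flow_of_equation`).

Finally Cauchy–Schwarz bounds M by the Gevrey norm, with a lattice sum bounded uniformly in r ≥ 3/2.
As 2^r C_W(r) ≥ 1/(2π), the constant C is absolute. -/

/-! ### Plane waves on the period cell. -/

/-- The plane wave `e^{i k·x}`. -/
def wave (k : Fin 2 → ℤ) (x : Fin 2 → ℝ) : ℂ :=
  Complex.exp (Complex.I * ((∑ j, (k j : ℝ) * x j : ℝ) : ℂ))

theorem continuous_wave (k : Fin 2 → ℤ) : Continuous (wave k) := by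
  unfold wave; fun_prop

theorem norm_wave (k : Fin 2 → ℤ) (x : Fin 2 → ℝ) : ‖wave k x‖ = 1 := by
  rw [wave, mul_comm, Complex.norm_exp_ofReal_mul_I]

theorem wave_add (k h : Fin 2 → ℤ) (x : Fin 2 → ℝ) : wave (k + h) x = wave k x * wave h x := by
  rw [wave, wave, wave, ← Complex.exp_add]
  congr 1
  simp only [Fin.sum_univ_two, Pi.add_apply]
  push_cast
  ring

theorem wave_neg (k : Fin 2 → ℤ) (x : Fin 2 → ℝ) :
    wave (-k) x = (starRingEnd ℂ) (wave k x) := by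
  rw [wave, wave, ← Complex.exp_conj]
  congr 1
  simp
  ring

theorem wave_zero (x : Fin 2 → ℝ) : wave 0 x = 1 := by
  simp [wave]

theorem wave_eq_prod (k : Fin 2 → ℤ) (x : Fin 2 → ℝ) :
    wave k x = ∏ j, Complex.exp (((k j : ℂ) * Complex.I) * (x j : ℂ)) := by
  rw [wave, ← Complex.exp_sum]
  congr 1
  simp only [Fin.sum_univ_two]
  push_cast
  ring

theorem coeff_eq (f : L2) (k : Fin 2 → ℤ) :
    coeff f k = (1 / (2 * Real.pi : ℂ) ^ 2) * ∫ x in Omega, f x * wave (-k) x := by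
  rw [coeff]
  congr 2
  ext x
  congr 2
  simp only [Fin.sum_univ_two, Pi.neg_apply]
  push_cast
  ring

theorem Omega_eq : Omega = Set.univ.pi fun _ : Fin 2 => Set.Icc 0 (2 * Real.pi) := by
  ext x
  simp [Omega, Pi.le_def]

instance : IsFiniteMeasure (volume.restrict Omega) := by
  refine ⟨?_⟩
  rw [Measure.restrict_apply_univ]
  exact (isCompact_Icc (a := (0 : Fin 2 → ℝ))).measure_lt_top

theorem integral_exp_int (n : ℤ) :
    ∫ x in Set.Icc 0 (2 * Real.pi), Complex.exp (((n : ℂ) * Complex.I) * (x : ℂ)) =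
      if n = 0 then 2 * Real.pi else 0 := by
  rw [integral_Icc_eq_integral_Ioc, ← intervalIntegral.integral_of_le Real.two_pi_pos.le]
  split_ifs with h
  · simp [h]
  · rw [integral_exp_mul_complex (by simpa using h)]
    have : Complex.exp ((n : ℂ) * Complex.I * ((2 * Real.pi : ℝ) : ℂ)) = 1 := by
      rw [Complex.exp_eq_one_iff]
      exact ⟨n, by push_cast; ring⟩
    rw [this]
    simp

theorem integral_wave (k : Fin 2 → ℤ) :
    ∫ x in Omega, wave k x = if k = 0 then (2 * Real.pi : ℂ) ^ 2 else 0 := by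
  simp_rw [wave_eq_prod]
  rw [Omega_eq, volume_pi, Measure.restrict_pi_pi,
    integral_fintype_prod_eq_prod (𝕜 := ℂ)
      (fun j (y : ℝ) => Complex.exp (((k j : ℂ) * Complex.I) * (y : ℂ)))]
  simp_rw [integral_exp_int]
  rw [Fin.prod_univ_two]
  have : k = 0 ↔ k 0 = 0 ∧ k 1 = 0 := by
    simp [funext_iff, Fin.forall_fin_two]
  split_ifs with h0 h1 h2 h3 <;> simp_all [sq]

/-! ### Completeness of the plane waves, by transfer to the unit torus. -/

/-- The covering map from the plane to the torus, of period `2π` in each variable. -/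
def torusMap (x : Fin 2 → ℝ) : UnitAddTorus (Fin 2) :=
  fun j => ((x j / (2 * Real.pi) : ℝ) : UnitAddCircle)

/-- The section of `torusMap` with values in `(0, 2π]²`. -/
def torusSection (t : UnitAddTorus (Fin 2)) : Fin 2 → ℝ :=
  fun j => 2 * Real.pi * (AddCircle.measurableEquivIoc 1 0 (t j) : ℝ)

theorem measurable_torusMap : Measurable torusMap := by
  refine measurable_pi_lambda _ fun j => ?_
  exact AddCircle.measurable_mk'.comp ((measurable_pi_apply j).div_const _)

theorem measurable_torusSection : Measurable torusSection := by
  refine measurable_pi_lambda _ fun j => ?_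
  exact (measurable_subtype_coe.comp
    ((AddCircle.measurableEquivIoc 1 0).measurable.comp (measurable_pi_apply j))).const_mul _

theorem torusSection_torusMap {x : Fin 2 → ℝ} (hx : ∀ j, x j ∈ Set.Ioc 0 (2 * Real.pi)) :
    torusSection (torusMap x) = x := by
  ext j
  have h : x j / (2 * Real.pi) ∈ Set.Ioc (0 : ℝ) (0 + 1) := by
    refine ⟨div_pos (hx j).1 Real.two_pi_pos, ?_⟩
    rw [zero_add]
    exact (div_le_one Real.two_pi_pos).2 (hx j).2
  have : AddCircle.equivIoc 1 0 ((x j / (2 * Real.pi) : ℝ) : UnitAddCircle) = ⟨_, h⟩ :=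
    AddCircle.equivIoc_coe_eq h
  change 2 * Real.pi * (AddCircle.equivIoc 1 0 ((x j / (2 * Real.pi) : ℝ) : UnitAddCircle) : ℝ) = _
  rw [this]
  have := Real.pi_ne_zero
  field_simp

theorem ae_torusSection_torusMap :
    ∀ᵐ x ∂(volume.restrict Omega), torusSection (torusMap x) = x := by
  have h : ∀ᵐ x ∂(volume.restrict Omega), ∀ j, x j ∈ Set.Ioc 0 (2 * Real.pi) := by
    rw [ae_all_iff]
    intro j
    rw [Omega_eq, volume_pi, Measure.restrict_pi_pi]
    refine (Measure.quasiMeasurePreserving_eval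
      (fun _ : Fin 2 => (volume : Measure ℝ).restrict (Set.Icc 0 (2 * Real.pi))) j).ae
      (p := fun y : ℝ => y ∈ Set.Ioc 0 (2 * Real.pi)) ?_
    rw [← restrict_Ioc_eq_restrict_Icc]
    exact ae_restrict_mem measurableSet_Ioc
  filter_upwards [h] with x hx using torusSection_torusMap hx

theorem mFourier_torusMap (k : Fin 2 → ℤ) (x : Fin 2 → ℝ) :
    UnitAddTorus.mFourier k (torusMap x) = wave k x := by
  rw [wave_eq_prod]
  change ∏ j, fourier (k j) (torusMap x j) = _
  refine Finset.prod_congr rfl fun j _ => ?_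
  rw [torusMap, fourier_coe_apply]
  congr 1
  have : (Real.pi : ℂ) ≠ 0 := by exact_mod_cast Real.pi_ne_zero
  push_cast
  field_simp

/-- Trigonometric polynomials are dense in the continuous functions on the torus, which are dense in
L² of any finite measure there. Hence the pushforward of Lebesgue measure need not be identified
with Haar measure. -/
theorem eq_zero_of_coeff_eq_zero {f : L2} (hf : ∀ k, coeff f k = 0) : f = 0 := by
  set μ : Measure (Fin 2 → ℝ) := volume.restrict Omega with hμ
  set ν : Measure (UnitAddTorus (Fin 2)) := μ.map torusMap with hν
  have hmap : ν.map torusSection = μ := by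
    rw [hν, Measure.map_map measurable_torusSection measurable_torusMap]
    refine (Measure.map_congr (g := id) ?_).trans Measure.map_id
    exact ae_torusSection_torusMap
  have hae : (fun x => f (torusSection (torusMap x))) =ᵐ[μ] f := by
    filter_upwards [ae_torusSection_torusMap] with x hx using by rw [hx]
  have hm : MemLp (f ∘ torusSection) 2 ν := by
    have h : MemLp f 2 (ν.map torusSection) := hmap ▸ Lp.memLp f
    exact h.comp_of_map measurable_torusSection.aemeasurable
  set F : Lp ℂ 2 ν := hm.toLp with hF
  have hfin : IsFiniteMeasure ν := by rw [hν]; infer_instance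
  -- The functional ⟨F, ·⟩ vanishes on the characters, hence on all continuous functions.
  have key : (innerSL ℂ F).comp (ContinuousMap.toLp (E := ℂ) 2 ν ℂ) = 0 := by
    refine ContinuousLinearMap.ext_on (s := Set.range (UnitAddTorus.mFourier (d := Fin 2))) ?_ ?_
    · rw [Submodule.dense_iff_topologicalClosure_eq_top]
      exact UnitAddTorus.span_mFourier_closure_eq_top
    · rintro _ ⟨k, rfl⟩
      have hk := hf (-(-k))
      simp only [ContinuousLinearMap.comp_apply, innerSL_apply_apply, zero_apply]
      rw [L2.inner_def]
      have h1 : ∫ t, inner ℂ (F t) ((ContinuousMap.toLp (E := ℂ) 2 ν ℂ)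
          (UnitAddTorus.mFourier k) t) ∂ν =
          ∫ t, inner ℂ (f (torusSection t)) (UnitAddTorus.mFourier k t) ∂ν := by
        refine integral_congr_ae ?_
        filter_upwards [hm.coeFn_toLp, ContinuousMap.coeFn_toLp (p := 2) (𝕜 := ℂ) ν
          (UnitAddTorus.mFourier k)] with t h1 h2
        rw [h2, hF, h1]; rfl
      rw [h1, hν, integral_map measurable_torusMap.aemeasurable]
      · have h2 : ∫ x, inner ℂ (f (torusSection (torusMap x)))
            (UnitAddTorus.mFourier k (torusMap x)) ∂μ =
            ∫ x, (starRingEnd ℂ) (f x * wave (-k) x) ∂μ := by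
          refine integral_congr_ae ?_
          filter_upwards [hae] with x hx
          rw [hx, mFourier_torusMap, wave_neg]
          simp [mul_comm]
        rw [h2, integral_conj]
        have h3 := hf k
        rw [coeff_eq, mul_eq_zero] at h3
        rcases h3 with h3 | h3
        · simp [Real.pi_ne_zero] at h3
        · rw [h3, map_zero]
      · refine AEStronglyMeasurable.inner (𝕜 := ℂ) hm.1 ?_
        exact (ContinuousMap.continuous _).aestronglyMeasurable
  have hF0 : F = 0 := by
    have hd := ContinuousMap.toLp_denseRange (E := ℂ) ℂ (μ := ν) (p := 2) ENNReal.ofNat_ne_top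
    have : innerSL ℂ F = 0 := by
      ext1 G
      have := hd.equalizer (innerSL ℂ F).continuous continuous_zero
        (by ext φ; exact congrArg (fun T => T φ) key)
      exact congrFun this G
    have h := congrArg (fun T => T F) this
    simpa using h
  have h0 : f ∘ torusSection =ᵐ[ν] 0 := by
    have := hm.coeFn_toLp
    rw [← hF, hF0] at this
    exact this.symm.trans (Lp.coeFn_zero _ _ _)
  have h1 := ae_of_ae_map measurable_torusMap.aemeasurable h0
  rw [Lp.eq_zero_iff_ae_eq_zero]
  filter_upwards [h1, hae] with x hx hx'
  rw [← hx']; exact hx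

theorem memLp_wave (k : Fin 2 → ℤ) : MemLp (wave k) 2 (volume.restrict Omega) :=
  MemLp.of_bound (continuous_wave k).aestronglyMeasurable 1
    (Eventually.of_forall fun x => (norm_wave k x).le)

/-! ### Fourier basis, Parseval and convolution. -/

/-- The plane waves, normalised in `L²(Ω)`. -/
def normalizedWave (k : Fin 2 → ℤ) : L2 := (2 * Real.pi : ℂ)⁻¹ • (memLp_wave k).toLp

theorem inner_normalizedWave (k : Fin 2 → ℤ) (f : L2) :
    inner ℂ (normalizedWave k) f = (2 * Real.pi : ℂ) * coeff f k := by
  have h : inner ℂ ((memLp_wave k).toLp) f = ∫ x in Omega, f x * wave (-k) x := by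
    rw [L2.inner_def]
    refine integral_congr_ae ?_
    filter_upwards [(memLp_wave k).coeFn_toLp] with x hx
    rw [hx, wave_neg]
    simp
  have hp : (Real.pi : ℂ) ≠ 0 := by exact_mod_cast Real.pi_ne_zero
  rw [normalizedWave, inner_smul_left, h, coeff_eq]
  simp only [map_inv₀, map_mul, Complex.conj_ofNat, Complex.conj_ofReal]
  field_simp

theorem coeff_eq_inner (f : L2) (k : Fin 2 → ℤ) :
    coeff f k = (2 * Real.pi : ℂ)⁻¹ * inner ℂ (normalizedWave k) f := by
  have hp : (Real.pi : ℂ) ≠ 0 := by exact_mod_cast Real.pi_ne_zero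
  rw [inner_normalizedWave]
  field_simp

theorem integral_wave_mul_wave_neg (k h : Fin 2 → ℤ) :
    ∫ x in Omega, wave k x * wave (-h) x = if k = h then (2 * Real.pi : ℂ) ^ 2 else 0 := by
  simp_rw [← wave_add]
  rw [integral_wave]
  simp only [← sub_eq_add_neg, sub_eq_zero]

theorem orthonormal_normalizedWave : Orthonormal ℂ normalizedWave := by
  rw [orthonormal_iff_ite]
  intro h k
  have hp : (Real.pi : ℂ) ≠ 0 := by exact_mod_cast Real.pi_ne_zero
  rw [inner_normalizedWave, coeff_eq]
  have : ∫ x in Omega, normalizedWave k x * wave (-h) x =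
      ∫ x in Omega, (2 * Real.pi : ℂ)⁻¹ * (wave k x * wave (-h) x) := by
    refine integral_congr_ae ?_
    filter_upwards [Lp.coeFn_smul (2 * Real.pi : ℂ)⁻¹ (memLp_wave k).toLp,
      (memLp_wave k).coeFn_toLp] with x h1 h2
    rw [normalizedWave, h1, Pi.smul_apply, h2, smul_eq_mul, mul_assoc]
  rw [this, integral_const_mul, integral_wave_mul_wave_neg]
  simp only [eq_comm (a := k)]
  split_ifs
  · field_simp
  · simp

/-- The Fourier basis of `L²(Ω)`. -/
def fourierBasis : HilbertBasis (Fin 2 → ℤ) ℂ L2 :=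
  HilbertBasis.mkOfOrthogonalEqBot orthonormal_normalizedWave (by
    rw [Submodule.eq_bot_iff]
    intro f hf
    refine eq_zero_of_coeff_eq_zero fun k => ?_
    rw [coeff_eq_inner, (Submodule.mem_orthogonal _ _).1 hf _ (Submodule.subset_span ⟨k, rfl⟩),
      mul_zero])

theorem fourierBasis_apply (k : Fin 2 → ℤ) : fourierBasis k = normalizedWave k := by
  rw [fourierBasis, HilbertBasis.coe_mkOfOrthogonalEqBot]

/-- The `k`-th Fourier coefficient as a continuous linear functional. -/
def coeffCLM (k : Fin 2 → ℤ) : L2 →L[ℂ] ℂ := (2 * Real.pi : ℂ)⁻¹ • innerSL ℂ (normalizedWave k)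

theorem coeffCLM_apply (k : Fin 2 → ℤ) (f : L2) : coeffCLM k f = coeff f k := by
  rw [coeff_eq_inner]; rfl

theorem coeff_add (f g : L2) (k : Fin 2 → ℤ) : coeff (f + g) k = coeff f k + coeff g k := by
  simp only [← coeffCLM_apply, map_add]

theorem coeff_smul (c : ℂ) (f : L2) (k : Fin 2 → ℤ) : coeff (c • f) k = c * coeff f k := by
  simp only [← coeffCLM_apply, map_smul, smul_eq_mul]

theorem ext_coeff {f g : L2} (h : ∀ k, coeff f k = coeff g k) : f = g := by
  rw [← sub_eq_zero]
  refine eq_zero_of_coeff_eq_zero fun k => ?_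
  rw [← coeffCLM_apply, map_sub, coeffCLM_apply, coeffCLM_apply, h, sub_self]

theorem hasSum_norm_coeff_sq (f : L2) :
    HasSum (fun k => ‖coeff f k‖ ^ 2) (((2 * Real.pi)⁻¹ * ‖f‖) ^ 2) := by
  have h := (fourierBasis.hasSum_inner_mul_inner f f).mapL (Complex.reCLM)
  have h' := h.mul_left ((2 * Real.pi)⁻¹ ^ 2)
  convert! h' using 1
  · ext k
    rw [fourierBasis_apply, ← inner_conj_symm, Complex.reCLM_apply, ← Complex.normSq_eq_conj_mul_self,
      Complex.ofReal_re, Complex.normSq_eq_norm_sq, coeff_eq_inner, norm_mul, mul_pow]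
    congr 2
    simp [Real.pi_pos.le]
  · rw [mul_pow, Complex.reCLM_apply, inner_self_eq_norm_sq_to_K]
    norm_cast

/-- Parseval for the pair ū·e^{ik·x} and g. The product u g is only integrable, yet its coefficients
are absolutely convergent convolutions. -/
theorem hasSum_coeff_mul (u g : L2) (k : Fin 2 → ℤ) :
    HasSum (fun h => coeff u (k - h) * coeff g h)
      ((1 / (2 * Real.pi : ℂ) ^ 2) * ∫ x in Omega, u x * g x * wave (-k) x) := by
  have hp : (Real.pi : ℂ) ≠ 0 := by exact_mod_cast Real.pi_ne_zero
  have hm : MemLp (fun x => (starRingEnd ℂ) (u x) * wave k x) 2 (volume.restrict Omega) := by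
    refine MemLp.of_le (Lp.memLp u) ?_ (Eventually.of_forall fun x => ?_)
    · exact (Complex.continuous_conj.comp_aestronglyMeasurable (Lp.aestronglyMeasurable u)).mul
        (continuous_wave k).aestronglyMeasurable
    · rw [norm_mul, norm_wave, mul_one, RCLike.norm_conj]
  have h := (fourierBasis.hasSum_inner_mul_inner hm.toLp g).mul_left (1 / (2 * Real.pi : ℂ) ^ 2)
  convert! h using 1
  · ext h
    have e : coeff u (k - h) = (2 * Real.pi : ℂ)⁻¹ * inner ℂ hm.toLp (normalizedWave h) := by
      rw [coeff_eq, L2.inner_def]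
      have : ∫ x in Omega, inner ℂ ((MemLp.toLp _ hm : L2) x) (normalizedWave h x) =
          ∫ x in Omega, (2 * Real.pi : ℂ)⁻¹ * (u x * wave (-(k - h)) x) := by
        refine integral_congr_ae ?_
        filter_upwards [Lp.coeFn_smul (2 * Real.pi : ℂ)⁻¹ (memLp_wave h).toLp,
          (memLp_wave h).coeFn_toLp, hm.coeFn_toLp] with x h1 h2 h3
        rw [normalizedWave, h1, Pi.smul_apply, h2, h3, neg_sub, sub_eq_add_neg, wave_add, wave_neg]
        simp
        ring
      rw [this, integral_const_mul]
      field_simp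
    rw [fourierBasis_apply, e, coeff_eq_inner]
    field_simp
  · congr 1
    rw [L2.inner_def]
    refine integral_congr_ae ?_
    filter_upwards [hm.coeFn_toLp] with x hx
    rw [hx, wave_neg]
    simp
    ring

theorem summable_norm_coeff_mul (u g : L2) (k : Fin 2 → ℤ) :
    Summable (fun h => ‖coeff u (k - h)‖ * ‖coeff g h‖) := by
  have := (hasSum_coeff_mul u g k).summable.norm
  simpa only [norm_mul] using this

/-! ### Absolutely convergent Fourier series. -/

/-- The Fourier series with absolutely summable coefficients `a`. -/
def series (a : (Fin 2 → ℤ) → ℂ) (x : Fin 2 → ℝ) : ℂ := ∑' k, a k * wave k x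

theorem continuous_series {a : (Fin 2 → ℤ) → ℂ} (ha : Summable fun k => ‖a k‖) :
    Continuous (series a) :=
  continuous_tsum (fun k => continuous_const.mul (continuous_wave k)) ha fun k x => by
    rw [norm_mul, norm_wave, mul_one]

theorem norm_series_le {a : (Fin 2 → ℤ) → ℂ} (ha : Summable fun k => ‖a k‖) (x : Fin 2 → ℝ) :
    ‖series a x‖ ≤ ∑' k, ‖a k‖ :=
  tsum_of_norm_bounded ha.hasSum fun k => by rw [norm_mul, norm_wave, mul_one]

theorem memLp_series {a : (Fin 2 → ℤ) → ℂ} (ha : Summable fun k => ‖a k‖) :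
    MemLp (series a) 2 (volume.restrict Omega) :=
  MemLp.of_bound (continuous_series ha).aestronglyMeasurable _
    (Eventually.of_forall (norm_series_le ha))

open Classical in
/-- The element of `L²(Ω)` with absolutely summable Fourier coefficients `a` (and `0` if `a` is
not absolutely summable). -/
def synth (a : (Fin 2 → ℤ) → ℂ) : L2 :=
  if ha : Summable fun k => ‖a k‖ then (memLp_series ha).toLp else 0

theorem synth_ae {a : (Fin 2 → ℤ) → ℂ} (ha : Summable fun k => ‖a k‖) :
    synth a =ᵐ[volume.restrict Omega] series a := by
  rw [synth, dif_pos ha]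
  exact (memLp_series ha).coeFn_toLp

theorem coeff_synth {a : (Fin 2 → ℤ) → ℂ} (ha : Summable fun k => ‖a k‖) (k : Fin 2 → ℤ) :
    coeff (synth a) k = a k := by
  have hp : (Real.pi : ℂ) ≠ 0 := by exact_mod_cast Real.pi_ne_zero
  have h1 : ∫ x in Omega, synth a x * wave (-k) x =
      ∫ x in Omega, ∑' h, a h * (wave h x * wave (-k) x) := by
    refine integral_congr_ae ?_
    filter_upwards [synth_ae ha] with x hx
    rw [hx, series, ← tsum_mul_right]
    simp only [mul_assoc]
  have hi : ∀ h, Integrable (fun x => a h * (wave h x * wave (-k) x)) (volume.restrict Omega) := by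
    intro h
    refine Integrable.of_bound (C := ‖a h‖) ?_ ?_
    · exact (continuous_const.mul ((continuous_wave h).mul
        (continuous_wave (-k)))).aestronglyMeasurable
    · exact Eventually.of_forall fun x => by simp [norm_wave]
  have h2 := hasSum_integral_of_summable_integral_norm (F := fun h x => a h * (wave h x * wave (-k) x))
    hi (by
      simp only [norm_mul, norm_wave, mul_one, integral_const, smul_eq_mul]
      exact ha.mul_left _)
  rw [coeff_eq, h1, ← h2.tsum_eq]
  simp_rw [integral_const_mul, integral_wave_mul_wave_neg]
  rw [tsum_eq_single k (by intro h hh; simp [hh])]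
  simp only [if_true]
  field_simp

theorem norm_synth_le {a : (Fin 2 → ℤ) → ℂ} (ha : Summable fun k => ‖a k‖) :
    ‖synth a‖ ≤ 2 * Real.pi * ∑' k, ‖a k‖ := by
  have h1 : HasSum (fun k => ‖a k‖ ^ 2) (((2 * Real.pi)⁻¹ * ‖synth a‖) ^ 2) := by
    simpa only [coeff_synth ha] using hasSum_norm_coeff_sq (synth a)
  set S := ∑' k, ‖a k‖ with hS
  have hS0 : 0 ≤ S := tsum_nonneg fun k => norm_nonneg _
  have h2 : ((2 * Real.pi)⁻¹ * ‖synth a‖) ^ 2 ≤ S ^ 2 := by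
    refine hasSum_le (fun k => ?_) h1 (f := fun k => ‖a k‖ ^ 2) (g := fun k => S * ‖a k‖) ?_
    · change ‖a k‖ ^ 2 ≤ S * ‖a k‖
      rw [sq]
      exact mul_le_mul_of_nonneg_right (ha.le_tsum k fun _ _ => norm_nonneg _) (norm_nonneg _)
    · rw [sq]
      exact ha.hasSum.mul_left S
  have h3 := abs_le_of_sq_le_sq' h2 hS0 |>.2
  rwa [inv_mul_le_iff₀ Real.two_pi_pos] at h3

/-- Cauchy product for a bounded bilinear map; absolute convergence allows summing along
antidiagonals. -/
theorem hasSum_antidiagonal_bilinear {E F G : Type*} [NormedAddCommGroup E] [NormedSpace ℂ E]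
    [NormedAddCommGroup F] [NormedSpace ℂ F] [NormedAddCommGroup G] [NormedSpace ℂ G]
    [CompleteSpace G] (B : E →L[ℂ] F →L[ℂ] G) {x : ℕ → E} {y : ℕ → F} {X : E} {Y : F}
    (hx : HasSum x X) (hy : HasSum y Y) (hx' : Summable fun n => ‖x n‖)
    (hy' : Summable fun n => ‖y n‖) :
    HasSum (fun n => ∑ p ∈ Finset.HasAntidiagonal.antidiagonal n, B (x p.1) (y p.2)) (B X Y) := by
  have hs : Summable fun p : ℕ × ℕ => B (x p.1) (y p.2) := by
    refine Summable.of_norm_bounded (g := fun p : ℕ × ℕ => ‖B‖ * (‖x p.1‖ * ‖y p.2‖)) ?_ ?_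
    · exact (hx'.mul_of_nonneg hy' (fun _ => norm_nonneg _) (fun _ => norm_nonneg _)).mul_left _
    · intro p
      rw [← mul_assoc]
      exact B.le_opNorm₂ _ _
  have h1 : HasSum (fun p : ℕ × ℕ => B (x p.1) (y p.2)) (B X Y) := by
    have h2 := hs.hasSum.prod_fiberwise (g := fun i => B (x i) Y) fun i => hy.mapL (B (x i))
    have h3 : HasSum (fun i => B (x i) Y) (B X Y) := hx.mapL (B.flip Y)
    exact h3.unique h2 ▸ hs.hasSum
  have h4 := (Finset.HasAntidiagonal.sigmaAntidiagonalEquivProd.hasSum_iff.2 h1).sigma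
    (g := fun n => ∑ p ∈ Finset.HasAntidiagonal.antidiagonal n, B (x p.1) (y p.2)) fun n => by
      rw [← Finset.sum_coe_sort]
      exact hasSum_fintype _
  exact h4

/-! ### The transport term in Fourier variables. -/

theorem len_nonneg (k : Fin 2 → ℤ) : 0 ≤ len k := Real.sqrt_nonneg _

theorem len_eq_norm (k : Fin 2 → ℤ) : len k = ‖WithLp.toLp 2 fun j => (k j : ℝ)‖ := by
  simp [len, EuclideanSpace.norm_eq]

theorem len_add_le (k h : Fin 2 → ℤ) : len (k + h) ≤ len k + len h := by
  simp only [len_eq_norm]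
  refine le_trans (le_of_eq ?_) (norm_add_le _ _)
  congr 1
  ext j
  simp

theorem len_le_len_sub_add (k h : Fin 2 → ℤ) : len k ≤ len (k - h) + len h := by
  simpa using len_add_le (k - h) h

theorem abs_cross_le (k h : Fin 2 → ℤ) :
    |(k 1 : ℝ) * h 0 - (k 0 : ℝ) * h 1| ≤ len k * len h := by
  rw [len, len, ← Real.sqrt_mul (by positivity)]
  refine Real.abs_le_sqrt ?_
  simp only [Fin.sum_univ_two]
  nlinarith [sq_nonneg ((k 0 : ℝ) * h 0 + (k 1 : ℝ) * h 1)]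

/-- The symbol `(k₂ h₁ - k₁ h₂) / |k - h|` of the interaction of the wave vectors `k - h` and `h`
in the nonlinearity. -/
def interaction (k h : Fin 2 → ℤ) : ℝ := ((k 1 : ℝ) * h 0 - (k 0 : ℝ) * h 1) / len (k - h)

/-- The cross product of k and h is unchanged, up to sign, when h is replaced by k - h, so |k - h|
cancels. This is the divergence form u·∇g = ∇·(u g): the derivative falls on the output frequency.
-/
theorem abs_interaction_le_left (k h : Fin 2 → ℤ) : |interaction k h| ≤ len k := by
  rw [interaction, abs_div, abs_of_nonneg (len_nonneg _)]
  refine div_le_of_le_mul₀ (len_nonneg _) (len_nonneg _) ?_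
  refine le_trans (le_of_eq ?_) (abs_cross_le k (k - h))
  rw [← abs_neg]
  congr 1
  simp only [Pi.sub_apply]
  push_cast
  ring

/-- Here k is replaced by k - h in the cross product, so the derivative falls on the second factor
alone. -/
theorem abs_interaction_le_right (k h : Fin 2 → ℤ) : |interaction k h| ≤ len h := by
  rw [interaction, abs_div, abs_of_nonneg (len_nonneg _)]
  refine div_le_of_le_mul₀ (len_nonneg _) (len_nonneg _) ?_
  rw [mul_comm (len h)]
  refine le_trans (le_of_eq ?_) (abs_cross_le (k - h) h)
  congr 1
  simp only [Pi.sub_apply]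
  push_cast
  ring

/-- The Fourier coefficients of the transport term `u·∇g`, where `u` is the velocity of a function
with Fourier coefficients `a`, and `g` has Fourier coefficients `b`. -/
def transport (a b : (Fin 2 → ℤ) → ℂ) (k : Fin 2 → ℤ) : ℂ :=
  ∑' h, (interaction k h : ℂ) * (a (k - h) * b h)

theorem norm_interaction_mul_le (a b : (Fin 2 → ℤ) → ℂ) (k h : Fin 2 → ℤ) :
    ‖(interaction k h : ℂ) * (a (k - h) * b h)‖ ≤ len k * (‖a (k - h)‖ * ‖b h‖) := by
  rw [norm_mul, norm_mul, Complex.norm_real, Real.norm_eq_abs]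
  exact mul_le_mul_of_nonneg_right (abs_interaction_le_left k h) (by positivity)

theorem summable_transport (f g : L2) (k : Fin 2 → ℤ) :
    Summable fun h => (interaction k h : ℂ) * (coeff f (k - h) * coeff g h) :=
  Summable.of_norm_bounded ((summable_norm_coeff_mul f g k).mul_left (len k))
    (norm_interaction_mul_le _ _ k)

/-- Cauchy–Schwarz after bounding the kernel by |k|. The bound grows with k, but for fixed k it
requires no derivative of f or g. -/
theorem norm_transport_le (f g : L2) (k : Fin 2 → ℤ) :
    ‖transport (coeff f) (coeff g) k‖ ≤ len k * ((2 * Real.pi)⁻¹) ^ 2 * ‖f‖ * ‖g‖ := by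
  have hf : HasSum (fun h => ‖coeff f (k - h)‖ ^ (2 : ℝ)) (((2 * Real.pi)⁻¹ * ‖f‖) ^ (2 : ℝ)) := by
    have := (Equiv.subLeft k).hasSum_iff.2 (hasSum_norm_coeff_sq f)
    simpa [Function.comp_def] using this
  have hg : HasSum (fun h => ‖coeff g h‖ ^ (2 : ℝ)) (((2 * Real.pi)⁻¹ * ‖g‖) ^ (2 : ℝ)) := by
    simpa using hasSum_norm_coeff_sq g
  have h1 := Real.inner_le_Lp_mul_Lq_tsum_of_nonneg (p := 2) (q := 2) Real.HolderConjugate.two_two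
    (fun h => norm_nonneg (coeff f (k - h))) (fun h => norm_nonneg (coeff g h))
    hf.summable hg.summable
  rw [hf.tsum_eq, hg.tsum_eq, ← Real.rpow_mul (by positivity), ← Real.rpow_mul (by positivity)] at h1
  norm_num at h1
  refine (tsum_of_norm_bounded ((summable_norm_coeff_mul f g k).mul_left (len k)).hasSum
    (norm_interaction_mul_le _ _ k)).trans ?_
  rw [tsum_mul_left]
  refine (mul_le_mul_of_nonneg_left h1 (len_nonneg k)).trans (le_of_eq ?_)
  ring

/-- The `k`-th Fourier coefficient of the transport term, as a bounded bilinear form on `L²(Ω)`. -/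
def transportCLM (k : Fin 2 → ℤ) : L2 →L[ℂ] L2 →L[ℂ] ℂ :=
  LinearMap.mkContinuous₂
    (LinearMap.mk₂ ℂ (fun f g => transport (coeff f) (coeff g) k)
      (fun f f' g => by
        simp only [transport]
        rw [← (summable_transport f g k).tsum_add (summable_transport f' g k)]
        congr 1; ext h; rw [coeff_add]; ring)
      (fun c f g => by
        simp only [transport, smul_eq_mul]
        rw [← tsum_mul_left]
        congr 1; ext h; rw [coeff_smul]; ring)
      (fun f g g' => by
        simp only [transport]
        rw [← (summable_transport f g k).tsum_add (summable_transport f g' k)]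
        congr 1; ext h; rw [coeff_add]; ring)
      (fun c f g => by
        simp only [transport, smul_eq_mul]
        rw [← tsum_mul_left]
        congr 1; ext h; rw [coeff_smul]; ring))
    (len k * ((2 * Real.pi)⁻¹) ^ 2) (fun f g => norm_transport_le f g k)

theorem transportCLM_apply (k : Fin 2 → ℤ) (f g : L2) :
    transportCLM k f g = transport (coeff f) (coeff g) k := rfl

theorem integral_transport {f : L2} {u g : Fin 2 → L2} (hu : IsVelocity f u) (hg : IsGradient f g)
    (k : Fin 2 → ℤ) :
    (1 / (2 * Real.pi : ℂ) ^ 2) * ∫ x in Omega, (∑ j, u j x * g j x) * wave (-k) x =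
      transport (coeff f) (coeff f) k := by
  have hi : ∀ j, Integrable (fun x => u j x * g j x * wave (-k) x) (volume.restrict Omega) := by
    intro j
    refine ((Lp.memLp (u j)).integrable_mul (Lp.memLp (g j))).mul_bdd (c := 1)
      (continuous_wave _).aestronglyMeasurable ?_
    exact Eventually.of_forall fun x => (norm_wave _ x).le
  simp only [Finset.sum_mul]
  rw [integral_finsetSum _ fun j _ => hi j, Finset.mul_sum]
  have := hasSum_sum (s := Finset.univ) fun j _ => hasSum_coeff_mul (u j) (g j) k
  rw [← this.tsum_eq, transport]
  congr 1
  ext h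
  simp only [Fin.sum_univ_two]
  rw [hu.1, hu.2, hg, hg]
  simp only [rieszSymbol, partialSymbol, interaction, Pi.sub_apply]
  push_cast
  -- The products of two components of h cancel, leaving the cross product of k and h.
  linear_combination (coeff f (k - h) * coeff f h) * ((k 0 : ℂ) - h 0) / len (k - h) * h 1 *
    Complex.I_sq - (coeff f (k - h) * coeff f h) * ((k 1 : ℂ) - h 1) / len (k - h) * h 0 *
    Complex.I_sq

theorem coeff_of_equation {f D : L2} {u g : Fin 2 → L2} (hu : IsVelocity f u)
    (hg : IsGradient f g)
    (h : ∀ᵐ x ∂(volume.restrict Omega), D x + ∑ j, u j x * g j x = 0) (k : Fin 2 → ℤ) :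
    coeff D k = -transport (coeff f) (coeff f) k := by
  rw [← integral_transport hu hg k, coeff_eq, ← mul_neg, ← integral_neg]
  congr 1
  refine integral_congr_ae ?_
  filter_upwards [h] with x hx
  rw [← neg_mul, eq_neg_of_add_eq_zero_left hx]

/-- Square integrability of u·∇f is assumed because completeness is available for L² functions,
whereas a product of two of them is a priori only integrable. -/
theorem equation_of_coeff {f D : L2} {u g : Fin 2 → L2} (hu : IsVelocity f u)
    (hg : IsGradient f g)
    (hm : MemLp (fun x => ∑ j, u j x * g j x) 2 (volume.restrict Omega))
    (h : ∀ k, coeff D k = -transport (coeff f) (coeff f) k) :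
    ∀ᵐ x ∂(volume.restrict Omega), D x + ∑ j, u j x * g j x = 0 := by
  have hD : D + hm.toLp = 0 := by
    refine eq_zero_of_coeff_eq_zero fun k => ?_
    rw [coeff_add, h, ← integral_transport hu hg k, coeff_eq, neg_add_eq_zero]
    congr 1
    refine integral_congr_ae ?_
    filter_upwards [hm.coeFn_toLp] with x hx
    rw [hx]
  have h1 := Lp.coeFn_add D hm.toLp
  rw [hD] at h1
  filter_upwards [h1, hm.coeFn_toLp, Lp.coeFn_zero ℂ 2 (volume.restrict Omega)] with x h1 h2 h3
  rw [← h2, ← Pi.add_apply, ← h1, h3]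
  rfl

/-! ### Weighted Wiener norms and the loss of one derivative. -/

/-- The weighted Wiener norm `∑_k e^{β|k|} |a_k|`. -/
def wienerNorm (β : ℝ) (a : (Fin 2 → ℤ) → ℂ) : ℝ≥0∞ :=
  ∑' k, ENNReal.ofReal (Real.exp (β * len k)) * ‖a k‖ₑ

theorem wienerNorm_mono {β β' : ℝ} (h : β ≤ β') (a : (Fin 2 → ℤ) → ℂ) :
    wienerNorm β a ≤ wienerNorm β' a := by
  refine ENNReal.tsum_le_tsum fun k => ?_
  gcongr
  exact len_nonneg k

theorem summable_of_wienerNorm {β : ℝ} {a : (Fin 2 → ℤ) → ℂ} (h : wienerNorm β a ≠ ∞) :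
    Summable fun k => Real.exp (β * len k) * ‖a k‖ := by
  have e : wienerNorm β a = ∑' k, ENNReal.ofReal (Real.exp (β * len k) * ‖a k‖) := by
    refine tsum_congr fun k => ?_
    rw [ENNReal.ofReal_mul (Real.exp_pos _).le, ofReal_norm]
  rw [e] at h
  have := ENNReal.summable_toReal h
  simpa only [ENNReal.toReal_ofReal (mul_nonneg (Real.exp_pos _).le (norm_nonneg _))] using this

theorem tsum_le_of_wienerNorm_le {β B : ℝ} (hB : 0 ≤ B) {a : (Fin 2 → ℤ) → ℂ}
    (h : wienerNorm β a ≤ ENNReal.ofReal B) : ∑' k, Real.exp (β * len k) * ‖a k‖ ≤ B := by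
  have hs := summable_of_wienerNorm (h.trans_lt ENNReal.ofReal_lt_top).ne
  rw [← ENNReal.ofReal_le_ofReal_iff hB, ENNReal.ofReal_tsum_of_nonneg
    (fun k => mul_nonneg (Real.exp_pos _).le (norm_nonneg _)) hs]
  refine le_trans (le_of_eq (tsum_congr fun k => ?_)) h
  rw [ENNReal.ofReal_mul (Real.exp_pos _).le, ofReal_norm]

/-- The weight is submultiplicative, e^{β|k|} ≤ e^{β|k-h|} e^{β|h|}, so Young's inequality ℓ¹ * ℓ¹ ⊂
ℓ¹ applies with the factor |h| kept on b. -/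
theorem wienerNorm_transport_le {β : ℝ} (hβ : 0 ≤ β) (a b : (Fin 2 → ℤ) → ℂ) :
    wienerNorm β (transport a b) ≤ wienerNorm β a *
      ∑' h, ENNReal.ofReal (Real.exp (β * len h)) * (ENNReal.ofReal (len h) * ‖b h‖ₑ) := by
  have h1 : wienerNorm β (transport a b) ≤ ∑' k, ∑' h,
      (ENNReal.ofReal (Real.exp (β * len (k - h))) * ‖a (k - h)‖ₑ) *
        (ENNReal.ofReal (Real.exp (β * len h)) * (ENNReal.ofReal (len h) * ‖b h‖ₑ)) := by
    refine ENNReal.tsum_le_tsum fun k => ?_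
    refine (mul_le_mul_right enorm_tsum_le_tsum_enorm _).trans ?_
    rw [← ENNReal.tsum_mul_left]
    refine ENNReal.tsum_le_tsum fun h => ?_
    rw [enorm_mul, enorm_mul]
    have e1 : ENNReal.ofReal (Real.exp (β * len k)) ≤
        ENNReal.ofReal (Real.exp (β * len (k - h))) * ENNReal.ofReal (Real.exp (β * len h)) := by
      rw [← ENNReal.ofReal_mul (Real.exp_pos _).le, ← Real.exp_add, ← mul_add]
      gcongr
      exact len_le_len_sub_add k h
    have e2 : ‖(interaction k h : ℂ)‖ₑ ≤ ENNReal.ofReal (len h) := by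
      rw [← ofReal_norm, Complex.norm_real]
      exact ENNReal.ofReal_le_ofReal (abs_interaction_le_right k h)
    calc _ ≤ (ENNReal.ofReal (Real.exp (β * len (k - h))) *
          ENNReal.ofReal (Real.exp (β * len h))) *
          (ENNReal.ofReal (len h) * (‖a (k - h)‖ₑ * ‖b h‖ₑ)) := by gcongr
      _ = _ := by ring
  refine h1.trans (le_of_eq ?_)
  rw [ENNReal.tsum_comm, ← ENNReal.tsum_mul_left]
  refine tsum_congr fun h => ?_
  rw [ENNReal.tsum_mul_right, wienerNorm]
  congr 1
  exact (Equiv.subRight h).tsum_eq fun k => ENNReal.ofReal (Real.exp (β * len k)) * ‖a k‖ₑ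

/-- Uses x ≤ e^{δx}/(eδ), which follows from y ≤ e^{y-1} at y = δx. -/
theorem wienerNorm_transport_le_of_pos {β δ : ℝ} (hβ : 0 ≤ β) (hδ : 0 < δ)
    (a b : (Fin 2 → ℤ) → ℂ) :
    wienerNorm β (transport a b) ≤ wienerNorm β a *
      (ENNReal.ofReal ((Real.exp 1 * δ)⁻¹) * wienerNorm (β + δ) b) := by
  refine (wienerNorm_transport_le hβ a b).trans ?_
  gcongr
  rw [wienerNorm, ← ENNReal.tsum_mul_left]
  refine ENNReal.tsum_le_tsum fun h => ?_
  rw [← mul_assoc, ← mul_assoc]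
  refine mul_le_mul_left ?_ _
  rw [← ENNReal.ofReal_mul (Real.exp_pos _).le, ← ENNReal.ofReal_mul (by positivity)]
  apply ENNReal.ofReal_le_ofReal
  have h1 : δ * len h ≤ Real.exp (δ * len h - 1) := by
    have := Real.add_one_le_exp (δ * len h - 1)
    linarith
  rw [add_mul, Real.exp_add, ← mul_assoc, mul_comm (Real.exp 1 * δ)⁻¹, mul_assoc]
  gcongr
  rw [inv_mul_eq_div, le_div_iff₀ (by positivity)]
  rw [Real.exp_sub, le_div_iff₀ (Real.exp_pos _)] at h1
  linarith

theorem wienerNorm_neg_inv_mul_sum_le {ι : Type*} (β : ℝ) (n : ℕ) (s : Finset ι)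
    (f : ι → (Fin 2 → ℤ) → ℂ) :
    wienerNorm β (fun k => -((n : ℂ) + 1)⁻¹ * ∑ i ∈ s, f i k) ≤
      ENNReal.ofReal (((n : ℝ) + 1)⁻¹) * ∑ i ∈ s, wienerNorm β (f i) := by
  have e : ‖-((n : ℂ) + 1)⁻¹‖ₑ = ENNReal.ofReal (((n : ℝ) + 1)⁻¹) := by
    rw [← ofReal_norm, norm_neg, norm_inv]
    congr 2
    rw [← Nat.cast_succ, Complex.norm_natCast]
    push_cast; rfl
  simp only [wienerNorm]
  rw [← Summable.tsum_finsetSum fun _ _ => ENNReal.summable, ← ENNReal.tsum_mul_left]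
  refine ENNReal.tsum_le_tsum fun k => ?_
  rw [enorm_mul, e, ← Finset.mul_sum, mul_left_comm]
  gcongr
  exact enorm_sum_le _ _

/-! ### Taylor coefficients and their Catalan majorant. -/

/-- The Fourier coefficients of the Taylor coefficients at `ζ = 0` of the solution whose initial
value has Fourier coefficients `a`. -/
def taylorCoeff (a : (Fin 2 → ℤ) → ℂ) : ℕ → (Fin 2 → ℤ) → ℂ
  | 0 => a
  | n + 1 => fun k => -((n : ℂ) + 1)⁻¹ *
      ∑ i : Fin n.succ, transport (taylorCoeff a i) (taylorCoeff a (n - i)) k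

theorem taylorCoeff_zero (a : (Fin 2 → ℤ) → ℂ) : taylorCoeff a 0 = a := by
  rw [taylorCoeff]

theorem taylorCoeff_succ (a : (Fin 2 → ℤ) → ℂ) (n : ℕ) :
    taylorCoeff a (n + 1) = fun k => -((n : ℂ) + 1)⁻¹ *
      ∑ p ∈ Finset.HasAntidiagonal.antidiagonal n,
        transport (taylorCoeff a p.1) (taylorCoeff a p.2) k := by
  rw [taylorCoeff]
  ext k
  rw [Finset.Nat.sum_antidiagonal_eq_sum_range_succ
    (fun i j => transport (taylorCoeff a i) (taylorCoeff a j) k), Finset.sum_range]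

/-- With q = 1 + 1/(j+1) one has d - d/(j+2) = d/q, and the ratio of the two sides is q^{j+1}/e ≤ 1.
-/
theorem inv_exp_mul_inv_pow_le {d : ℝ} (hd : 0 < d) (j : ℕ) :
    (Real.exp 1 * (d / (j + 2)))⁻¹ * ((d - d / (j + 2)) ^ j)⁻¹ ≤ (j + 1) / d ^ (j + 1) := by
  have hq : (1 + 1 / ((j : ℝ) + 1)) ^ (j + 1) ≤ Real.exp 1 := by
    have h1 : 1 + 1 / ((j : ℝ) + 1) ≤ Real.exp (1 / ((j : ℝ) + 1)) := by
      rw [add_comm]; exact Real.add_one_le_exp _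
    calc _ ≤ Real.exp (1 / ((j : ℝ) + 1)) ^ (j + 1) := by gcongr
      _ = Real.exp 1 := by
        rw [← Real.exp_nat_mul]
        congr 1
        push_cast
        field_simp
  set q := 1 + 1 / ((j : ℝ) + 1) with hqdef
  have hq0 : 0 < q := by positivity
  have e1 : (j : ℝ) + 2 = (j + 1) * q := by rw [hqdef]; field_simp; ring
  have e2 : d - d / (j + 2) = d / q := by
    rw [hqdef]; field_simp; ring
  rw [e2, e1]
  have e3 : (Real.exp 1 * (d / ((j + 1) * q)))⁻¹ * ((d / q) ^ j)⁻¹ =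
      (j + 1) / d ^ (j + 1) * (q ^ (j + 1) / Real.exp 1) := by
    rw [div_pow]
    field_simp
    ring
  rw [e3]
  refine mul_le_of_le_one_right (by positivity) ?_
  exact (div_le_one (Real.exp_pos 1)).2 hq

theorem wienerNorm_taylorCoeff_le_catalan {a : (Fin 2 → ℤ) → ℂ} {β₀ M : ℝ} (hM : 0 ≤ M)
    (ha : wienerNorm β₀ a ≤ ENNReal.ofReal M) (n : ℕ) :
    ∀ β, 0 ≤ β → β < β₀ → wienerNorm β (taylorCoeff a n) ≤
      ENNReal.ofReal (catalan n * M ^ (n + 1) / (β₀ - β) ^ n) := by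
  induction n using Nat.strong_induction_on with
  | _ n ih =>
    intro β hβ hβ'
    rcases n with _ | n
    · simpa [taylorCoeff_zero] using (wienerNorm_mono hβ'.le a).trans ha
    rw [taylorCoeff_succ]
    refine (wienerNorm_neg_inv_mul_sum_le β n _ _).trans ?_
    have hd : 0 < β₀ - β := sub_pos.2 hβ'
    have key : ∀ p ∈ Finset.HasAntidiagonal.antidiagonal n,
        wienerNorm β (transport (taylorCoeff a p.1) (taylorCoeff a p.2)) ≤
          ENNReal.ofReal ((n + 1) * (catalan p.1 * catalan p.2) * M ^ (n + 2) /
            (β₀ - β) ^ (n + 1)) := by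
      rintro ⟨i, j⟩ hp
      have hij : i + j = n := by simpa using hp
      -- For d = β₀ - β, this width is close to the maximiser d/(j+1) of δ(d-δ)^j. The shift to j +
      -- 2 keeps β + δ < β₀ when j = 0.
      have hδ : 0 < (β₀ - β) / (j + 2) := by positivity
      have hδ' : (β₀ - β) / (j + 2) < β₀ - β := by
        apply div_lt_self hd
        have : (0 : ℝ) ≤ j := Nat.cast_nonneg j
        linarith
      refine (wienerNorm_transport_le_of_pos hβ hδ _ _).trans ?_
      refine (mul_le_mul' (ih i (by omega) β hβ hβ') (mul_le_mul_right (ih j (by omega)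
        (β + (β₀ - β) / (j + 2)) (by positivity) (by linarith)) _)).trans ?_
      rw [← ENNReal.ofReal_mul (by positivity), ← ENNReal.ofReal_mul (by positivity)]
      apply ENNReal.ofReal_le_ofReal
      have e := inv_exp_mul_inv_pow_le hd j
      -- This factor n + 1 is cancelled by the inverse in the recurrence, so no factorial growth
      -- appears.
      have hjn : ((j : ℝ) + 1) ≤ n + 1 := by
        have : (j : ℝ) ≤ n := by exact_mod_cast (by omega : j ≤ n)
        linarith
      calc _ = (catalan i * M ^ (i + 1) / (β₀ - β) ^ i * (catalan j * M ^ (j + 1))) *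
            ((Real.exp 1 * ((β₀ - β) / (j + 2)))⁻¹ *
              (((β₀ - β) - (β₀ - β) / (j + 2)) ^ j)⁻¹) := by
              rw [← sub_sub]; ring
        _ ≤ (catalan i * M ^ (i + 1) / (β₀ - β) ^ i * (catalan j * M ^ (j + 1))) *
            ((n + 1) / (β₀ - β) ^ (j + 1)) := by
              refine mul_le_mul_of_nonneg_left (e.trans ?_) (by positivity)
              gcongr
        _ = _ := by
              subst hij
              field_simp
              ring
    refine (mul_le_mul_right (Finset.sum_le_sum key) _).trans ?_
    rw [← ENNReal.ofReal_sum_of_nonneg (fun p _ => by positivity),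
      ← ENNReal.ofReal_mul (by positivity)]
    apply ENNReal.ofReal_le_ofReal
    rw [catalan_succ', ← Finset.sum_div, ← Finset.sum_mul, ← Finset.mul_sum]
    push_cast
    refine le_of_eq ?_
    field_simp

theorem wienerNorm_taylorCoeff_le {a : (Fin 2 → ℤ) → ℂ} {β β₀ M : ℝ} (hM : 0 ≤ M)
    (ha : wienerNorm β₀ a ≤ ENNReal.ofReal M) (hβ : 0 ≤ β) (hβ' : β < β₀) (n : ℕ) :
    wienerNorm β (taylorCoeff a n) ≤ ENNReal.ofReal (M * (4 * M / (β₀ - β)) ^ n) := by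
  refine (wienerNorm_taylorCoeff_le_catalan hM ha n β hβ hβ').trans ?_
  apply ENNReal.ofReal_le_ofReal
  have hd : 0 < β₀ - β := sub_pos.2 hβ'
  have h4 : (catalan n : ℝ) ≤ 4 ^ n := by
    have : catalan n ≤ 4 ^ n := by
      rw [catalan_eq_centralBinom_div]
      exact (Nat.div_le_self _ _).trans (Nat.centralBinom_le_four_pow n)
    exact_mod_cast this
  calc _ ≤ 4 ^ n * M ^ (n + 1) / (β₀ - β) ^ n := by gcongr
    _ = _ := by rw [div_pow, mul_pow]; ring

/-! ### Power series in ζ with values in a Banach space. -/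

section PowerSeries

variable {E : Type*} [NormedAddCommGroup E] [NormedSpace ℂ E]

theorem norm_pow_smul_le {X : ℕ → E} {s : ℝ} (n : ℕ) {z : ℂ} (hz : z ∈ Metric.ball (0 : ℂ) s) :
    ‖z ^ n • X n‖ ≤ s ^ n * ‖X n‖ := by
  rw [norm_smul, norm_pow]
  gcongr
  exact (mem_ball_zero_iff.1 hz).le

theorem summable_norm_powerSeries {X : ℕ → E} {s : ℝ} (hX : Summable fun n => s ^ n * ‖X n‖)
    {z : ℂ} (hz : z ∈ Metric.ball (0 : ℂ) s) : Summable fun n => ‖z ^ n • X n‖ :=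
  hX.of_nonneg_of_le (fun _ => norm_nonneg _) fun n => norm_pow_smul_le n hz

variable [CompleteSpace E]

theorem hasSum_powerSeries {X : ℕ → E} {s : ℝ} (hX : Summable fun n => s ^ n * ‖X n‖)
    {z : ℂ} (hz : z ∈ Metric.ball (0 : ℂ) s) :
    HasSum (fun n => z ^ n • X n) (∑' n, z ^ n • X n) :=
  (summable_norm_powerSeries hX hz).of_norm.hasSum

theorem differentiableOn_powerSeries {X : ℕ → E} {s : ℝ}
    (hX : Summable fun n => s ^ n * ‖X n‖) :
    DifferentiableOn ℂ (fun z : ℂ => ∑' n, z ^ n • X n) (Metric.ball 0 s) :=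
  Complex.differentiableOn_tsum_of_summable_norm hX
    (fun n => ((differentiable_id.pow n).smul_const (X n)).differentiableOn) Metric.isOpen_ball
    fun n _ hz => norm_pow_smul_le n hz

theorem hasSum_deriv_powerSeries {X : ℕ → E} {s : ℝ}
    (hX : Summable fun n => s ^ n * ‖X n‖) {z : ℂ} (hz : z ∈ Metric.ball (0 : ℂ) s) :
    HasSum (fun n : ℕ => (((n : ℂ) + 1) * z ^ n) • X (n + 1))
      (deriv (fun z : ℂ => ∑' n, z ^ n • X n) z) := by
  have h := Complex.hasSum_deriv_of_summable_norm (F := fun n (w : ℂ) => w ^ n • X n) hX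
    (fun n => ((differentiable_id.pow n).smul_const (X n)).differentiableOn) Metric.isOpen_ball
    (fun n _ hz => norm_pow_smul_le n hz) hz
  have e : ∀ n : ℕ, deriv (fun w : ℂ => w ^ n • X n) z = ((n : ℂ) * z ^ (n - 1)) • X n := by
    intro n
    exact ((hasDerivAt_pow n z).smul_const (X n)).deriv
  simp only [e] at h
  rw [← hasSum_nat_add_iff' 1] at h
  simpa using h

end PowerSeries

/-- Identity theorem when the value at z = 0 is not known, since the equation is given only on a
punctured disc. -/
theorem eq_zero_of_hasSum_powerSeries_zero {c : ℕ → ℂ} {s : ℝ} (hs : 0 < s)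
    (h : ∀ z : ℂ, z ≠ 0 → ‖z‖ < s → HasSum (fun n => z ^ n * c n) 0) (n : ℕ) : c n = 0 := by
  let p : FormalMultilinearSeries ℂ ℂ ℂ := fun n => ContinuousMultilinearMap.mkPiRing ℂ (Fin n) (c n)
  have hp : ∀ n, p.coeff n = c n := fun n => by simp [p, FormalMultilinearSeries.coeff]
  -- The sum at z = 0 is c 0; continuity of the sum then forces c 0 = 0.
  let f : ℂ → ℂ := fun z => if z = 0 then c 0 else 0
  have hf : HasFPowerSeriesAt f p 0 := by
    rw [hasFPowerSeriesAt_iff]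
    filter_upwards [Metric.ball_mem_nhds (0 : ℂ) hs] with z hz
    rw [zero_add]
    simp only [hp, smul_eq_mul]
    by_cases h0 : z = 0
    · subst h0
      have := hasSum_single (f := fun n => (0 : ℂ) ^ n * c n) 0 (fun n hn => by simp [hn])
      simpa [f] using this
    · simpa [f, h0] using h z h0 (mem_ball_zero_iff.1 hz)
  have hc0 : c 0 = 0 := by
    have h1 : Tendsto f (𝓝[≠] 0) (𝓝 (f 0)) := hf.continuousAt.tendsto.mono_left nhdsWithin_le_nhds
    have h2 : Tendsto f (𝓝[≠] 0) (𝓝 0) := by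
      refine tendsto_const_nhds.congr' ?_
      filter_upwards [self_mem_nhdsWithin] with z hz
      exact (if_neg hz).symm
    simpa [f] using tendsto_nhds_unique h1 h2
  have hf0 : f = 0 := by
    ext z
    simp [f, hc0]
  have hp0 : p = 0 := by
    rw [hf0] at hf
    exact hf.eq_zero
  rw [← hp, hp0]
  simp [FormalMultilinearSeries.coeff]

theorem exists_rpow_le_mul_exp {r δ : ℝ} (hr : 0 ≤ r) (hδ : 0 < δ) :
    ∃ K : ℝ, 0 ≤ K ∧ ∀ x : ℝ, 0 ≤ x → x ^ r ≤ K * Real.exp (δ * x) := by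
  obtain ⟨m, hm⟩ := exists_nat_ge r
  refine ⟨1 + m.factorial / δ ^ m, by positivity, fun x hx => ?_⟩
  have h1 : 1 ≤ Real.exp (δ * x) := Real.one_le_exp (by positivity)
  have h2 : x ^ m ≤ m.factorial / δ ^ m * Real.exp (δ * x) := by
    have := Real.pow_div_factorial_le_exp (δ * x) (by positivity) m
    rw [div_le_iff₀ (by positivity), mul_pow] at this
    rw [div_mul_eq_mul_div, le_div_iff₀ (by positivity)]
    linarith
  have h3 : x ^ r ≤ 1 + x ^ m := by
    rcases le_total x 1 with h | h
    · exact (Real.rpow_le_one hx h hr).trans (le_add_of_nonneg_right (by positivity))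
    · have := Real.rpow_le_rpow_of_exponent_le h hm
      rw [Real.rpow_natCast] at this
      linarith
  linarith

theorem wienerNorm_zero_mul_le {m a : (Fin 2 → ℤ) → ℂ} {β K : ℝ} (hK : 0 ≤ K)
    (hm : ∀ k, ‖m k‖ ≤ K * Real.exp (β * len k)) :
    wienerNorm 0 (fun k => m k * a k) ≤ ENNReal.ofReal K * wienerNorm β a := by
  rw [wienerNorm, wienerNorm, ← ENNReal.tsum_mul_left]
  refine ENNReal.tsum_le_tsum fun k => ?_
  rw [zero_mul, Real.exp_zero, ENNReal.ofReal_one, one_mul, enorm_mul, ← mul_assoc,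
    ← ENNReal.ofReal_mul hK, ← ofReal_norm (m k)]
  exact mul_le_mul_left (ENNReal.ofReal_le_ofReal (hm k)) _

/-! ### Convergence of the series under Fourier multipliers. -/

/-- The power series in `ζ` whose coefficients are the images of the Taylor coefficients of the
solution under the Fourier multiplier with symbol `m`. -/
def multiplierFlow (a m : (Fin 2 → ℤ) → ℂ) (z : ℂ) : L2 :=
  ∑' n : ℕ, z ^ n • synth fun k => m k * taylorCoeff a n k

section Flow

variable {a m : (Fin 2 → ℤ) → ℂ} {β β₀ M K s : ℝ}

theorem wienerNorm_mul_taylorCoeff_le (hM : 0 ≤ M) (ha : wienerNorm β₀ a ≤ ENNReal.ofReal M)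
    (hβ : 0 ≤ β) (hβ' : β < β₀) (hK : 0 ≤ K) (hm : ∀ k, ‖m k‖ ≤ K * Real.exp (β * len k)) (n : ℕ) :
    wienerNorm 0 (fun k => m k * taylorCoeff a n k) ≤
      ENNReal.ofReal (K * (M * (4 * M / (β₀ - β)) ^ n)) := by
  rw [ENNReal.ofReal_mul hK]
  exact (wienerNorm_zero_mul_le hK hm).trans
    (mul_le_mul_right (wienerNorm_taylorCoeff_le hM ha hβ hβ' n) _)

theorem summable_norm_of_wienerNorm_zero {b : (Fin 2 → ℤ) → ℂ} (h : wienerNorm 0 b ≠ ∞) :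
    Summable fun k => ‖b k‖ := by
  simpa using summable_of_wienerNorm h

theorem summable_mul_taylorCoeff (hM : 0 ≤ M) (ha : wienerNorm β₀ a ≤ ENNReal.ofReal M)
    (hβ : 0 ≤ β) (hβ' : β < β₀) (hK : 0 ≤ K) (hm : ∀ k, ‖m k‖ ≤ K * Real.exp (β * len k)) (n : ℕ) :
    Summable fun k => ‖m k * taylorCoeff a n k‖ :=
  summable_norm_of_wienerNorm_zero ((wienerNorm_mul_taylorCoeff_le hM ha hβ hβ' hK hm n).trans_lt
    ENNReal.ofReal_lt_top).ne

theorem summable_geometric_bound (hM : 0 ≤ M) (hβ' : β < β₀) (hs : 0 ≤ s)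
    (hsM : 4 * M * s < β₀ - β) :
    Summable fun n : ℕ => s ^ n * (K * (M * (4 * M / (β₀ - β)) ^ n)) := by
  have hd : 0 < β₀ - β := sub_pos.2 hβ'
  have h := (summable_geometric_of_lt_one (r := 4 * M * s / (β₀ - β)) (by positivity)
    ((div_lt_one hd).2 hsM)).mul_left (K * M)
  refine h.congr fun n => ?_
  rw [mul_div_right_comm, mul_pow]
  ring

theorem summable_norm_flow (hM : 0 ≤ M) (ha : wienerNorm β₀ a ≤ ENNReal.ofReal M)
    (hβ : 0 ≤ β) (hβ' : β < β₀) (hK : 0 ≤ K) (hm : ∀ k, ‖m k‖ ≤ K * Real.exp (β * len k))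
    (hs : 0 ≤ s) (hsM : 4 * M * s < β₀ - β) :
    Summable fun n : ℕ => s ^ n * ‖synth fun k => m k * taylorCoeff a n k‖ := by
  have hd : 0 < β₀ - β := sub_pos.2 hβ'
  refine Summable.of_nonneg_of_le (fun n => by positivity) (fun n => ?_)
    ((summable_geometric_bound (K := K) hM hβ' hs hsM).mul_left (2 * Real.pi))
  rw [mul_left_comm]
  refine mul_le_mul_of_nonneg_left ?_ (by positivity)
  refine (norm_synth_le (summable_mul_taylorCoeff hM ha hβ hβ' hK hm n)).trans ?_
  refine mul_le_mul_of_nonneg_left ?_ Real.two_pi_pos.le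
  simpa using tsum_le_of_wienerNorm_le (by positivity)
    (wienerNorm_mul_taylorCoeff_le hM ha hβ hβ' hK hm n)

theorem hasSum_coeff_flow (hM : 0 ≤ M) (ha : wienerNorm β₀ a ≤ ENNReal.ofReal M)
    (hβ : 0 ≤ β) (hβ' : β < β₀) (hK : 0 ≤ K) (hm : ∀ k, ‖m k‖ ≤ K * Real.exp (β * len k))
    (hs : 0 ≤ s) (hsM : 4 * M * s < β₀ - β) {z : ℂ} (hz : z ∈ Metric.ball (0 : ℂ) s)
    (k : Fin 2 → ℤ) :
    HasSum (fun n => z ^ n * (m k * taylorCoeff a n k)) (coeff (multiplierFlow a m z) k) := by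
  have h := (hasSum_powerSeries (summable_norm_flow hM ha hβ hβ' hK hm hs hsM) hz).mapL
    (coeffCLM k)
  simp only [map_smul, coeffCLM_apply, smul_eq_mul,
    coeff_synth (summable_mul_taylorCoeff hM ha hβ hβ' hK hm _)] at h
  exact h

theorem norm_one_le (hβ : 0 ≤ β) (k : Fin 2 → ℤ) : ‖(1 : ℂ)‖ ≤ 1 * Real.exp (β * len k) := by
  rw [norm_one, one_mul]
  exact Real.one_le_exp (mul_nonneg hβ (len_nonneg k))

theorem isMultiplierImage_flow (hM : 0 ≤ M) (ha : wienerNorm β₀ a ≤ ENNReal.ofReal M)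
    (hβ : 0 ≤ β) (hβ' : β < β₀) (hK : 0 ≤ K) (hm : ∀ k, ‖m k‖ ≤ K * Real.exp (β * len k))
    (hs : 0 ≤ s) (hsM : 4 * M * s < β₀ - β) {z : ℂ} (hz : z ∈ Metric.ball (0 : ℂ) s) :
    IsMultiplierImage m (multiplierFlow a 1 z) (multiplierFlow a m z) := by
  intro k
  have h1 := hasSum_coeff_flow hM ha hβ hβ' zero_le_one (m := 1) (norm_one_le hβ) hs hsM hz k
  refine (hasSum_coeff_flow hM ha hβ hβ' hK hm hs hsM hz k).unique ?_
  convert! h1.mul_left (m k) using 2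
  simp only [Pi.one_apply]
  ring

/-- Applied to the Riesz symbols, this makes the velocity bounded, so that u·∇η lies in L². -/
theorem wienerNorm_coeff_flow_ne_top (hM : 0 ≤ M) (ha : wienerNorm β₀ a ≤ ENNReal.ofReal M)
    (hβ : 0 ≤ β) (hβ' : β < β₀) (hK : 0 ≤ K) (hm : ∀ k, ‖m k‖ ≤ K * Real.exp (β * len k))
    (hs : 0 ≤ s) (hsM : 4 * M * s < β₀ - β) {z : ℂ} (hz : z ∈ Metric.ball (0 : ℂ) s) :
    wienerNorm 0 (coeff (multiplierFlow a m z)) ≠ ∞ := by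
  have hd : 0 < β₀ - β := sub_pos.2 hβ'
  have hsum := summable_geometric_bound (K := K) hM hβ' hs hsM
  refine ne_top_of_le_ne_top (b := ENNReal.ofReal (∑' n : ℕ, s ^ n * (K * (M * (4 * M / (β₀ - β)) ^ n))))
    ENNReal.ofReal_ne_top ?_
  rw [ENNReal.ofReal_tsum_of_nonneg (fun n => by positivity) hsum]
  calc _ ≤ ∑' k, ∑' n : ℕ, ENNReal.ofReal (s ^ n) * ‖m k * taylorCoeff a n k‖ₑ := by
        refine ENNReal.tsum_le_tsum fun k => ?_
        rw [zero_mul, Real.exp_zero, ENNReal.ofReal_one, one_mul,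
          ← (hasSum_coeff_flow hM ha hβ hβ' hK hm hs hsM hz k).tsum_eq]
        refine enorm_tsum_le_tsum_enorm.trans (ENNReal.tsum_le_tsum fun n => ?_)
        rw [enorm_mul, ← ofReal_norm (z ^ n), norm_pow]
        gcongr
        exact (mem_ball_zero_iff.1 hz).le
    _ = ∑' n : ℕ, ENNReal.ofReal (s ^ n) * wienerNorm 0 (fun k => m k * taylorCoeff a n k) := by
        rw [ENNReal.tsum_comm]
        simp [wienerNorm, ENNReal.tsum_mul_left]
    _ ≤ _ := by
        refine ENNReal.tsum_le_tsum fun n => ?_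
        rw [ENNReal.ofReal_mul (by positivity)]
        exact mul_le_mul_right (wienerNorm_mul_taylorCoeff_le hM ha hβ hβ' hK hm n) _

end Flow

theorem memLp_mul_of_summable_coeff {u : L2} (hu : Summable fun k => ‖coeff u k‖) (g : L2) :
    MemLp (fun x => u x * g x) 2 (volume.restrict Omega) := by
  have hus : u = synth (coeff u) := ext_coeff fun k => (coeff_synth hu k).symm
  have hb : ∀ᵐ x ∂(volume.restrict Omega), ‖u x‖ ≤ ∑' k, ‖coeff u k‖ := by
    have := synth_ae hu
    rw [← hus] at this
    filter_upwards [this] with x hx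
    rw [hx]
    exact norm_series_le hu x
  refine MemLp.of_le_mul (c := ∑' k, ‖coeff u k‖) (Lp.memLp g)
    ((Lp.aestronglyMeasurable u).mul (Lp.aestronglyMeasurable g)) ?_
  filter_upwards [hb] with x hx
  rw [norm_mul]
  gcongr

/-! ### Coefficients in ζ of the two sides of the equation. -/

section Recurrence

variable {X : ℕ → L2} {s : ℝ}

theorem hasSum_coeff_deriv (hX : Summable fun n => s ^ n * ‖X n‖) {z : ℂ}
    (hz : z ∈ Metric.ball (0 : ℂ) s) (k : Fin 2 → ℤ) :
    HasSum (fun n : ℕ => z ^ n * (((n : ℂ) + 1) * coeff (X (n + 1)) k))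
      (coeff (deriv (fun z : ℂ => ∑' n, z ^ n • X n) z) k) := by
  have h := (hasSum_deriv_powerSeries hX hz).mapL (coeffCLM k)
  simp only [map_smul, coeffCLM_apply, smul_eq_mul] at h
  refine h.congr_fun fun n => ?_
  ring

theorem hasSum_transport (hX : Summable fun n => s ^ n * ‖X n‖) {z : ℂ}
    (hz : z ∈ Metric.ball (0 : ℂ) s) (k : Fin 2 → ℤ) :
    HasSum (fun n : ℕ => z ^ n * ∑ p ∈ Finset.HasAntidiagonal.antidiagonal n,
        transport (coeff (X p.1)) (coeff (X p.2)) k)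
      (transport (coeff (∑' n, z ^ n • X n)) (coeff (∑' n, z ^ n • X n)) k) := by
  have h := hasSum_antidiagonal_bilinear (transportCLM k) (hasSum_powerSeries hX hz)
    (hasSum_powerSeries hX hz) (summable_norm_powerSeries hX hz) (summable_norm_powerSeries hX hz)
  rw [transportCLM_apply] at h
  refine h.congr_fun fun n => ?_
  rw [Finset.mul_sum]
  refine Finset.sum_congr rfl fun p hp => ?_
  rw [← Finset.HasAntidiagonal.mem_antidiagonal.1 hp, map_smul, map_smul, smul_apply,
    transportCLM_apply, smul_eq_mul, smul_eq_mul, pow_add]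
  ring

end Recurrence

theorem norm_partialSymbol_le (j : Fin 2) (k : Fin 2 → ℤ) : ‖partialSymbol j k‖ ≤ len k := by
  rw [partialSymbol, norm_mul, Complex.norm_I, one_mul, Complex.norm_intCast, len]
  refine Real.abs_le_sqrt ?_
  exact Finset.single_le_sum (f := fun j => (k j : ℝ) ^ 2) (fun i _ => sq_nonneg _)
    (Finset.mem_univ j)

theorem norm_rieszSymbol_le (j : Fin 2) (k : Fin 2 → ℤ) : ‖rieszSymbol j k‖ ≤ 1 := by
  have := norm_partialSymbol_le j k
  rw [partialSymbol] at this
  rw [rieszSymbol, norm_div, Complex.norm_real, Real.norm_of_nonneg (len_nonneg k)]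
  exact div_le_one_of_le₀ this (len_nonneg k)

/-! ### The power series solves the equation. -/

section Existence

variable {a : (Fin 2 → ℤ) → ℂ} {β β₀ M s : ℝ}

theorem summable_norm_flow_one (hM : 0 ≤ M) (ha : wienerNorm β₀ a ≤ ENNReal.ofReal M)
    (hs : 0 < s) (hsM : 4 * M * s < β₀) :
    Summable fun n : ℕ => s ^ n * ‖synth fun k => (1 : (Fin 2 → ℤ) → ℂ) k * taylorCoeff a n k‖ :=
  summable_norm_flow (β := 0) (m := 1) hM ha le_rfl (by nlinarith) zero_le_one
    (norm_one_le le_rfl) hs.le (by linarith)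

theorem coeff_synth_taylorCoeff (hM : 0 ≤ M) (ha : wienerNorm β₀ a ≤ ENNReal.ofReal M)
    (hβ₀ : 0 < β₀) (n : ℕ) :
    coeff (synth fun k => (1 : (Fin 2 → ℤ) → ℂ) k * taylorCoeff a n k) = taylorCoeff a n := by
  ext k
  rw [coeff_synth (summable_mul_taylorCoeff (β := 0) (m := 1) hM ha le_rfl hβ₀ zero_le_one
    (norm_one_le le_rfl) n)]
  simp

theorem coeff_deriv_flow (hM : 0 ≤ M) (ha : wienerNorm β₀ a ≤ ENNReal.ofReal M)
    (hs : 0 < s) (hsM : 4 * M * s < β₀) {z : ℂ} (hz : z ∈ Metric.ball (0 : ℂ) s)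
    (k : Fin 2 → ℤ) :
    coeff (deriv (multiplierFlow a 1) z) k =
      -transport (coeff (multiplierFlow a 1 z)) (coeff (multiplierFlow a 1 z)) k := by
  have hβ₀ : 0 < β₀ := by nlinarith
  have hX := summable_norm_flow_one hM ha hs hsM
  have h1 := hasSum_coeff_deriv hX hz k
  have h2 := (hasSum_transport hX hz k).neg
  refine h1.unique ?_
  refine h2.congr_fun fun n => ?_
  simp only [coeff_synth_taylorCoeff hM ha hβ₀]
  rw [taylorCoeff_succ]
  have : (n : ℂ) + 1 ≠ 0 := by exact_mod_cast n.succ_ne_zero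
  field_simp

theorem differentiableOn_flow_one (hM : 0 ≤ M) (ha : wienerNorm β₀ a ≤ ENNReal.ofReal M)
    (hs : 0 < s) (hsM : 4 * M * s < β₀) :
    DifferentiableOn ℂ (multiplierFlow a 1) (Metric.ball 0 s) :=
  differentiableOn_powerSeries (summable_norm_flow_one hM ha hs hsM)

theorem exists_equation_flow (hM : 0 ≤ M) (ha : wienerNorm β₀ a ≤ ENNReal.ofReal M)
    (hs : 0 < s) (hsM : 4 * M * s < β₀) {z : ℂ} (hz : z ∈ Metric.ball (0 : ℂ) s) :
    ∃ (D : L2) (u g : Fin 2 → L2), HasDerivAt (multiplierFlow a 1) D z ∧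
      IsVelocity (multiplierFlow a 1 z) u ∧ IsGradient (multiplierFlow a 1 z) g ∧
      ∀ᵐ x ∂(volume.restrict Omega), D x + ∑ j, u j x * g j x = 0 := by
  -- Half of the spare analyticity radius is spent on the multipliers; the gradient needs β > 0,
  -- through |k| ≤ β⁻¹ e^{β|k|}.
  obtain ⟨β, hβ, hβs⟩ : ∃ β, 0 < β ∧ 4 * M * s < β₀ - β :=
    ⟨(β₀ - 4 * M * s) / 2, by linarith, by linarith⟩
  have hβ' : β < β₀ := by
    have : 0 ≤ 4 * M * s := by positivity
    linarith
  have hp : ∀ j k, ‖partialSymbol j k‖ ≤ β⁻¹ * Real.exp (β * len k) := by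
    intro j k
    refine (norm_partialSymbol_le j k).trans ?_
    rw [inv_mul_eq_div, le_div_iff₀ hβ, mul_comm]
    linarith [Real.add_one_le_exp (β * len k)]
  have hr : ∀ j k, ‖rieszSymbol j k‖ ≤ 1 * Real.exp (β * len k) := by
    intro j k
    refine (norm_rieszSymbol_le j k).trans ?_
    rw [one_mul]
    exact Real.one_le_exp (mul_nonneg hβ.le (len_nonneg k))
  have hr' : ∀ j k, ‖-rieszSymbol j k‖ ≤ 1 * Real.exp (β * len k) := by
    intro j k
    rw [norm_neg]
    exact hr j k
  let v : Fin 2 → (Fin 2 → ℤ) → ℂ := ![fun k => -rieszSymbol 1 k, rieszSymbol 0]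
  have hv : ∀ j k, ‖v j k‖ ≤ 1 * Real.exp (β * len k) := by
    intro j
    fin_cases j
    · exact hr' 1
    · exact hr 0
  have hu : ∀ j, IsMultiplierImage (v j) (multiplierFlow a 1 z) (multiplierFlow a (v j) z) :=
    fun j => isMultiplierImage_flow hM ha hβ.le hβ' zero_le_one (hv j) hs.le hβs hz
  have hvel : IsVelocity (multiplierFlow a 1 z) fun j => multiplierFlow a (v j) z :=
    ⟨hu 0, hu 1⟩
  have hgrad : IsGradient (multiplierFlow a 1 z) fun j => multiplierFlow a (partialSymbol j) z :=
    fun j => isMultiplierImage_flow hM ha hβ.le hβ' (inv_nonneg.2 hβ.le) (hp j) hs.le hβs hz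
  refine ⟨deriv (multiplierFlow a 1) z, _, _, ?_, hvel, hgrad, ?_⟩
  · exact ((differentiableOn_flow_one hM ha hs hsM).differentiableAt
      (Metric.isOpen_ball.mem_nhds hz)).hasDerivAt
  · refine equation_of_coeff hvel hgrad ?_ fun k => coeff_deriv_flow hM ha hs hsM hz k
    refine memLp_finsetSum _ fun j _ => ?_
    exact memLp_mul_of_summable_coeff (summable_norm_of_wienerNorm_zero
      (wienerNorm_coeff_flow_ne_top hM ha hβ.le hβ' zero_le_one (hv j) hs.le hβs hz)) _

theorem gevreyHolomorphicAt_flow {r : ℝ} (hr : 0 ≤ r) (hM : 0 ≤ M)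
    (ha : wienerNorm β₀ a ≤ ENNReal.ofReal M) (hs : 0 < s) (hsM : 4 * M * s < β₀) {z : ℂ}
    (hz : z ∈ Metric.ball (0 : ℂ) s) : GevreyHolomorphicAt r (multiplierFlow a 1) z := by
  -- The symbol needs width 2β: one β for its exponential and one to dominate |k|^r.
  obtain ⟨β, hβ, hβs⟩ : ∃ β, 0 < β ∧ 4 * M * s < β₀ - 2 * β :=
    ⟨(β₀ - 4 * M * s) / 4, by linarith, by linarith⟩
  have hβ' : 2 * β < β₀ := by
    have : 0 ≤ 4 * M * s := by positivity
    linarith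
  obtain ⟨K, hK, hKexp⟩ := exists_rpow_le_mul_exp hr hβ
  have hm : ∀ k, ‖(gevreySymbol r β k : ℂ)‖ ≤ K * Real.exp (2 * β * len k) := by
    intro k
    rw [Complex.norm_real, gevreySymbol, Real.norm_of_nonneg
      (mul_nonneg (Real.rpow_nonneg (len_nonneg k) r) (Real.exp_pos _).le), two_mul, add_mul,
      Real.exp_add, ← mul_assoc]
    exact mul_le_mul_of_nonneg_right (hKexp _ (len_nonneg k)) (Real.exp_pos _).le
  refine ⟨β, hβ, multiplierFlow a fun k => (gevreySymbol r β k : ℂ), ?_, ?_⟩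
  · exact (differentiableOn_powerSeries (summable_norm_flow hM ha (by positivity) hβ' hK hm hs.le
      hβs)).analyticAt (Metric.isOpen_ball.mem_nhds hz)
  · filter_upwards [Metric.isOpen_ball.mem_nhds hz] with w hw
    exact isMultiplierImage_flow hM ha (by positivity) hβ' hK hm hs.le hβs hw

theorem flow_zero (hM : 0 ≤ M) (ha : wienerNorm β₀ a ≤ ENNReal.ofReal M) (hβ₀ : 0 < β₀)
    {f : L2} (hf : coeff f = a) : multiplierFlow a 1 0 = f := by
  rw [multiplierFlow, tsum_eq_single 0 (fun n hn => by simp [hn]), pow_zero, one_smul]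
  refine ext_coeff fun k => ?_
  rw [coeff_synth_taylorCoeff hM ha hβ₀, taylorCoeff_zero, hf]

theorem transport_zero (a b : (Fin 2 → ℤ) → ℂ) : transport a b 0 = 0 := by
  simp [transport, interaction]

theorem taylorCoeff_apply_zero (ha : a 0 = 0) (n : ℕ) : taylorCoeff a n 0 = 0 := by
  cases n with
  | zero => rw [taylorCoeff_zero, ha]
  | succ n => simp [taylorCoeff_succ, transport_zero]

theorem meanZero_iff (f : L2) : MeanZero f ↔ coeff f 0 = 0 := by
  have hp : (Real.pi : ℂ) ≠ 0 := by exact_mod_cast Real.pi_ne_zero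
  rw [coeff_eq, MeanZero]
  simp [wave_zero, hp]

theorem meanZero_flow (hM : 0 ≤ M) (ha : wienerNorm β₀ a ≤ ENNReal.ofReal M) (ha0 : a 0 = 0)
    (hs : 0 < s) (hsM : 4 * M * s < β₀) {z : ℂ} (hz : z ∈ Metric.ball (0 : ℂ) s) :
    MeanZero (multiplierFlow a 1 z) := by
  rw [meanZero_iff]
  refine (hasSum_coeff_flow (β := 0) hM ha le_rfl (by nlinarith) zero_le_one
    (m := 1) (norm_one_le le_rfl) hs.le (by linarith) hz 0).unique ?_
  simp only [taylorCoeff_apply_zero ha0, mul_zero]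
  exact hasSum_zero

end Existence

/-! ### Every solution is given by the same power series. -/

section Uniqueness

variable {a : (Fin 2 → ℤ) → ℂ} {β₀ M s : ℝ}

theorem eq_flow_of_equation {η₀ : L2} (hM : 0 ≤ M)
    (ha : wienerNorm β₀ (coeff η₀) ≤ ENNReal.ofReal M) (hs : 0 < s) (hsM : 4 * M * s < β₀)
    {η : ℂ → L2} (h0 : η 0 = η₀) (hcont : ContinuousAt η 0)
    (heq : ∀ z ∈ Metric.ball (0 : ℂ) s, z ≠ 0 → ∃ (D : L2) (u g : Fin 2 → L2),
      HasDerivAt η D z ∧ IsVelocity (η z) u ∧ IsGradient (η z) g ∧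
      ∀ᵐ x ∂(volume.restrict Omega), D x + ∑ j, u j x * g j x = 0)
    {z : ℂ} (hz : z ∈ Metric.ball (0 : ℂ) s) : η z = multiplierFlow (coeff η₀) 1 z := by
  have hβ₀ : 0 < β₀ := by nlinarith
  -- With ‖z‖ < t < ρ < s, the Cauchy integral lives on the circle of radius ρ, and its series
  -- converges absolutely at radius t.
  obtain ⟨ρ, hzρ, hρs⟩ := exists_between (mem_ball_zero_iff.1 hz)
  obtain ⟨t, hzt, htρ⟩ := exists_between hzρ
  have ht : 0 < t := (norm_nonneg z).trans_lt hzt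
  have hρ : 0 < ρ := ht.trans htρ
  have hdiff : ∀ w ∈ Metric.ball (0 : ℂ) s, w ≠ 0 → DifferentiableAt ℂ η w := by
    intro w hw hw0
    obtain ⟨D, u, g, hD, -⟩ := heq w hw hw0
    exact hD.differentiableAt
  lift ρ to NNReal using hρ.le
  -- Removable singularity: continuity at the exceptional point 0 suffices.
  have hps := Complex.hasFPowerSeriesOnBall_of_differentiable_off_countable (f := η) (c := 0)
    (R := ρ) (Set.countable_singleton 0) (fun w hw => by
      by_cases hw0 : w = 0
      · rw [hw0]; exact hcont.continuousWithinAt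
      · refine (hdiff w ?_ hw0).continuousAt.continuousWithinAt
        exact Metric.closedBall_subset_ball hρs hw)
    (fun w hw => hdiff w (Metric.ball_subset_ball hρs.le hw.1) hw.2) (by exact_mod_cast hρ)
  set p := cauchyPowerSeries η 0 ρ with hp
  set X : ℕ → L2 := fun n => p.coeff n with hXdef
  have hX : Summable fun n => t ^ n * ‖X n‖ := by
    lift t to NNReal using ht.le
    have h := p.summable_norm_mul_pow (r := t)
      (lt_of_lt_of_le (by exact_mod_cast htρ) hps.r_le)
    refine h.congr fun n => ?_
    rw [FormalMultilinearSeries.norm_apply_eq_norm_coef, mul_comm]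
  have hsum : ∀ w ∈ Metric.ball (0 : ℂ) t, η w = ∑' n, w ^ n • X n := by
    intro w hw
    have h := hps.hasSum (y := w) (by
      rw [Metric.mem_eball, edist_zero_right, enorm_eq_nnnorm, ENNReal.coe_lt_coe]
      exact_mod_cast (mem_ball_zero_iff.1 hw).trans htρ)
    simp only [FormalMultilinearSeries.apply_eq_pow_smul_coeff, zero_add] at h
    exact h.tsum_eq.symm
  have hrec : ∀ (n : ℕ) (k : Fin 2 → ℤ), ((n : ℂ) + 1) * coeff (X (n + 1)) k +
      ∑ q ∈ Finset.HasAntidiagonal.antidiagonal n, transport (coeff (X q.1)) (coeff (X q.2)) k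
        = 0 := by
    intro n k
    refine eq_zero_of_hasSum_powerSeries_zero (c := fun n : ℕ => ((n : ℂ) + 1) * coeff (X (n + 1)) k +
      ∑ q ∈ Finset.HasAntidiagonal.antidiagonal n, transport (coeff (X q.1)) (coeff (X q.2)) k)
      ht (fun w hw0 hw => ?_) n
    have hwt : w ∈ Metric.ball (0 : ℂ) t := mem_ball_zero_iff.2 hw
    obtain ⟨D, u, g, hD, hu, hg, he⟩ :=
      heq w (mem_ball_zero_iff.2 (hw.trans (htρ.trans hρs))) hw0
    have h1 := (hasSum_coeff_deriv hX hwt k).add (hasSum_transport hX hwt k)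
    have hev : (fun w : ℂ => ∑' n, w ^ n • X n) =ᶠ[𝓝 w] η := by
      filter_upwards [Metric.isOpen_ball.mem_nhds hwt] with v hv using (hsum v hv).symm
    rw [hev.deriv_eq, hD.deriv, ← hsum w hwt, coeff_of_equation hu hg he k, neg_add_cancel] at h1
    refine h1.congr_fun fun n => ?_
    rw [mul_add]
  have hcoeff : ∀ n, coeff (X n) = taylorCoeff (coeff η₀) n := by
    intro n
    induction n using Nat.strong_induction_on with
    | _ n ih =>
      rcases n with _ | n
      · rw [taylorCoeff_zero, ← h0, hsum 0 (Metric.mem_ball_self ht),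
          tsum_eq_single 0 (fun n hn => by simp [hn]), pow_zero, one_smul]
      · ext k
        have h := hrec n k
        have hn : (n : ℂ) + 1 ≠ 0 := by exact_mod_cast n.succ_ne_zero
        have e : ∑ q ∈ Finset.HasAntidiagonal.antidiagonal n,
            transport (coeff (X q.1)) (coeff (X q.2)) k =
            ∑ q ∈ Finset.HasAntidiagonal.antidiagonal n,
            transport (taylorCoeff (coeff η₀) q.1) (taylorCoeff (coeff η₀) q.2) k := by
          refine Finset.sum_congr rfl fun q hq => ?_
          have hq' := Finset.HasAntidiagonal.mem_antidiagonal.1 hq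
          rw [ih q.1 (by omega), ih q.2 (by omega)]
        rw [e] at h
        rw [taylorCoeff_succ]
        field_simp
        linear_combination h
  rw [hsum z (mem_ball_zero_iff.2 hzt), multiplierFlow]
  refine tsum_congr fun n => ?_
  congr 1
  refine ext_coeff fun k => ?_
  rw [hcoeff, coeff_synth_taylorCoeff hM ha hβ₀]

end Uniqueness

/-! ### From the Gevrey norm to the Wiener norm, uniformly in r. -/

theorem one_le_len {k : Fin 2 → ℤ} (hk : k ≠ 0) : 1 ≤ len k := by
  rw [len, Real.one_le_sqrt]
  obtain ⟨j, hj⟩ := Function.ne_iff.1 hk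
  have h1 : (1 : ℝ) ≤ (k j : ℝ) ^ 2 := by
    have : 0 < (k j) ^ 2 := sq_pos_of_ne_zero hj
    exact_mod_cast this
  exact h1.trans (Finset.single_le_sum (f := fun j => (k j : ℝ) ^ 2) (fun i _ => sq_nonneg _)
    (Finset.mem_univ j))

theorem norm_le_len (k : Fin 2 → ℤ) : ‖k‖ ≤ len k := by
  refine (pi_norm_le_iff_of_nonneg (len_nonneg k)).2 fun j => ?_
  have := norm_partialSymbol_le j k
  rwa [partialSymbol, norm_mul, Complex.norm_I, one_mul, Complex.norm_intCast] at this

/-- An absolute constant bounding `∑_{k ≠ 0} |k|^{-2r}` for all `r ≥ 3/2`. -/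
def latticeSum : ℝ := ∑' k : Fin 2 → ℤ, ‖k‖ ^ (-3 : ℝ)

theorem summable_lattice : Summable fun k : Fin 2 → ℤ => ‖k‖ ^ (-3 : ℝ) :=
  EisensteinSeries.summable_one_div_norm_rpow (by norm_num)

theorem latticeSum_nonneg : 0 ≤ latticeSum :=
  tsum_nonneg fun _ => Real.rpow_nonneg (norm_nonneg _) _

/-- Since |k| ≥ 1 off the origin, |k|^{-2r} is largest at r = 3/2; this removes r from the constant.
-/
theorem len_rpow_neg_le {r : ℝ} (hr : 3 / 2 ≤ r) {k : Fin 2 → ℤ} (hk : k ≠ 0) :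
    (len k ^ (-r)) ^ 2 ≤ ‖k‖ ^ (-3 : ℝ) := by
  rw [← Real.rpow_natCast, ← Real.rpow_mul (len_nonneg k)]
  calc len k ^ (-r * (2 : ℕ)) ≤ len k ^ (-3 : ℝ) := by
        refine Real.rpow_le_rpow_of_exponent_le (one_le_len hk) ?_
        push_cast
        linarith
    _ ≤ ‖k‖ ^ (-3 : ℝ) := Real.rpow_le_rpow_of_nonpos (norm_pos_iff.2 hk) (norm_le_len k) (by norm_num)

theorem gevreyNorm_eq {r β : ℝ} {f : L2} (h : gevreyNorm r β f < ⊤) :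
    (Summable fun k => (gevreySymbol r β k * ‖coeff f k‖) ^ 2) ∧
      (gevreyNorm r β f).toReal =
        2 * Real.pi * (∑' k, (gevreySymbol r β k * ‖coeff f k‖) ^ 2) ^ (1 / 2 : ℝ) := by
  have h1 : ∑' k, ENNReal.ofReal ((gevreySymbol r β k * ‖coeff f k‖) ^ 2) ≠ ∞ := by
    intro htop
    rw [gevreyNorm, htop, ENNReal.top_rpow_of_pos (by norm_num), ENNReal.mul_top] at h
    · exact h.ne rfl
    · simpa using Real.pi_pos
  have h2 : Summable fun k => (gevreySymbol r β k * ‖coeff f k‖) ^ 2 := by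
    have := ENNReal.summable_toReal h1
    simpa only [ENNReal.toReal_ofReal (sq_nonneg _)] using this
  refine ⟨h2, ?_⟩
  rw [gevreyNorm, ENNReal.toReal_mul, ENNReal.toReal_ofReal Real.two_pi_pos.le,
    ← ENNReal.toReal_rpow, ← ENNReal.ofReal_tsum_of_nonneg (fun _ => sq_nonneg _) h2,
    ENNReal.toReal_ofReal (tsum_nonneg fun _ => sq_nonneg _)]

theorem wienerNorm_le_gevreyNorm {r β : ℝ} (hr : 3 / 2 ≤ r) {f : L2} (hf : MeanZero f)
    (h : gevreyNorm r β f < ⊤) :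
    wienerNorm β (coeff f) ≤ ENNReal.ofReal
      (latticeSum ^ (1 / 2 : ℝ) * ((2 * Real.pi)⁻¹ * (gevreyNorm r β f).toReal)) := by
  obtain ⟨hs, e⟩ := gevreyNorm_eq h
  have hf0 := (meanZero_iff f).1 hf
  rw [e, inv_mul_cancel_left₀ Real.two_pi_pos.ne']
  -- Cauchy–Schwarz weight. The value at k = 0 is harmless because f has mean zero.
  let w : (Fin 2 → ℤ) → ℝ := fun k => if k = 0 then 0 else len k ^ (-r)
  have hw0 : ∀ k, 0 ≤ w k := fun k => by
    dsimp only [w]; split_ifs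
    · exact le_rfl
    · exact Real.rpow_nonneg (len_nonneg k) _
  have hw : ∀ k, w k ^ (2 : ℝ) ≤ ‖k‖ ^ (-3 : ℝ) := fun k => by
    rw [Real.rpow_two]
    dsimp only [w]; split_ifs with hk
    · simp
    · exact len_rpow_neg_le hr hk
  have hwe : ∀ k, w k * (gevreySymbol r β k * ‖coeff f k‖) =
      Real.exp (β * len k) * ‖coeff f k‖ := fun k => by
    dsimp only [w]; split_ifs with hk
    · simp [hk, hf0]
    · have hl : 0 < len k := zero_lt_one.trans_le (one_le_len hk)
      rw [gevreySymbol, ← mul_assoc, ← mul_assoc, ← Real.rpow_add hl, neg_add_cancel,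
        Real.rpow_zero, one_mul]
  have hws : Summable fun k => w k ^ (2 : ℝ) :=
    summable_lattice.of_nonneg_of_le (fun k => Real.rpow_nonneg (hw0 k) _) hw
  have hg0 : ∀ k, 0 ≤ gevreySymbol r β k * ‖coeff f k‖ := fun k =>
    mul_nonneg (mul_nonneg (Real.rpow_nonneg (len_nonneg k) _) (Real.exp_pos _).le) (norm_nonneg _)
  have hs' : Summable fun k => (gevreySymbol r β k * ‖coeff f k‖) ^ (2 : ℝ) := by
    simpa only [Real.rpow_two] using hs
  obtain ⟨h1, h2⟩ := Real.summable_and_inner_le_Lp_mul_Lq_tsum_of_nonneg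
    Real.HolderConjugate.two_two hw0 hg0 hws hs'
  simp only [hwe, Real.rpow_two] at h1 h2
  have e1 : wienerNorm β (coeff f) =
      ENNReal.ofReal (∑' k, Real.exp (β * len k) * ‖coeff f k‖) := by
    rw [ENNReal.ofReal_tsum_of_nonneg (fun k => by positivity) h1]
    refine tsum_congr fun k => ?_
    rw [ENNReal.ofReal_mul (Real.exp_pos _).le, ofReal_norm]
  rw [e1]
  apply ENNReal.ofReal_le_ofReal
  refine h2.trans (mul_le_mul_of_nonneg_right ?_ (Real.rpow_nonneg (tsum_nonneg fun _ => sq_nonneg _) _))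
  simp only [Real.rpow_two] at hws hw
  exact Real.rpow_le_rpow (tsum_nonneg fun _ => sq_nonneg _) (hws.tsum_le_tsum hw summable_lattice)
    (by norm_num)

theorem inv_two_pi_le {r : ℝ} (hr : 3 / 2 < r) : (2 * Real.pi)⁻¹ ≤ 2 ^ r * wienerConst r := by
  have h1 : (1 : ℝ) ≤ 2 ^ r := Real.one_le_rpow (by norm_num) (by linarith)
  have h2 : 1 ≤ (2 * r - 2) / (2 * r - 3) := by
    rw [le_div_iff₀ (by linarith)]; linarith
  rw [wienerConst, one_div]
  calc (2 * Real.pi)⁻¹ = 1 * ((2 * Real.pi)⁻¹ * 1) := by ring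
    _ ≤ _ := by gcongr

/-- The absolute constant governing the size of the region of existence. -/
def radiusConst : ℝ := (4 * (latticeSum ^ (1 / 2 : ℝ) + 1))⁻¹

theorem radiusConst_pos : 0 < radiusConst := by
  have := Real.rpow_nonneg latticeSum_nonneg (1 / 2)
  unfold radiusConst
  positivity

/-- Places the stated disc inside the disc of convergence. The + 1 in `radiusConst` avoids any need
for a positive lower bound on `latticeSum`. -/
theorem four_mul_lt_of_region {r β₀ N t : ℝ} (hr : 3 / 2 < r) (hN : 0 ≤ N)
    (ht : 0 ≤ t) (h : 2 ^ r * wienerConst r * N * t < radiusConst * β₀) :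
    4 * (latticeSum ^ (1 / 2 : ℝ) * ((2 * Real.pi)⁻¹ * N)) * t < β₀ := by
  have hL := Real.rpow_nonneg latticeSum_nonneg (1 / 2)
  have hq : (2 * Real.pi)⁻¹ * (N * t) ≤ 2 ^ r * wienerConst r * (N * t) :=
    mul_le_mul_of_nonneg_right (inv_two_pi_le hr) (by positivity)
  rw [radiusConst, inv_mul_eq_div, lt_div_iff₀ (by positivity)] at h
  have h0 : 0 ≤ (2 * Real.pi)⁻¹ * (N * t) := by positivity
  nlinarith [mul_le_mul_of_nonneg_right hq hL]

end

end SQG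

/-! ### Assembly of the theorem. -/

theorem theorem4p1 :
    ∃ C : ℝ, 0 < C ∧
      ∀ (r β₀ : ℝ) (η₀ : SQG.L2), 3 / 2 < r → 0 < β₀ → SQG.MeanZero η₀ →
        SQG.gevreyNorm r β₀ η₀ < ⊤ →
        ∃ η : ℂ → SQG.L2,
          SQG.IsSolution η₀ (SQG.region C r β₀ (SQG.gevreyNorm r β₀ η₀).toReal) η ∧
          (∀ ζ ∈ insert 0 (SQG.region C r β₀ (SQG.gevreyNorm r β₀ η₀).toReal),
            SQG.GevreyHolomorphicAt r η ζ) ∧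
          ∀ η₁ : ℂ → SQG.L2,
            SQG.IsSolution η₀ (SQG.region C r β₀ (SQG.gevreyNorm r β₀ η₀).toReal) η₁ →
            ∀ ζ ∈ SQG.region C r β₀ (SQG.gevreyNorm r β₀ η₀).toReal, η₁ ζ = η ζ := by
  refine ⟨SQG.radiusConst, SQG.radiusConst_pos, fun r β₀ η₀ hr hβ₀ hη₀ hfin => ?_⟩
  set N := (SQG.gevreyNorm r β₀ η₀).toReal with hN
  have hN0 : 0 ≤ N := ENNReal.toReal_nonneg
  have ha := SQG.wienerNorm_le_gevreyNorm hr.le hη₀ hfin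
  rw [← hN] at ha
  set M := SQG.latticeSum ^ (1 / 2 : ℝ) * ((2 * Real.pi)⁻¹ * N) with hM
  have hM0 : 0 ≤ M := mul_nonneg (Real.rpow_nonneg SQG.latticeSum_nonneg _) (by positivity)
  -- The inequality defining the region is strict, so each of its points lies in a slightly larger
  -- disc which, punctured, is still in the region.
  have hradius : ∀ t : ℝ, 0 ≤ t → 2 ^ r * SQG.wienerConst r * N * t < SQG.radiusConst * β₀ →
      ∃ s, t < s ∧ 4 * M * s < β₀ ∧
        ∀ z ∈ Metric.ball (0 : ℂ) s, z ≠ 0 → z ∈ SQG.region SQG.radiusConst r β₀ N := by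
    intro t ht h
    have hA : 0 ≤ 2 ^ r * SQG.wienerConst r * N :=
      mul_nonneg ((inv_nonneg.2 Real.two_pi_pos.le).trans (SQG.inv_two_pi_le hr)) hN0
    have hev : ∀ᶠ s in 𝓝[>] t, 2 ^ r * SQG.wienerConst r * N * s < SQG.radiusConst * β₀ := by
      refine nhdsWithin_le_nhds ?_
      exact (continuous_const.mul continuous_id).continuousAt.eventually_lt continuousAt_const h
    obtain ⟨s, hs, hts⟩ := (hev.and self_mem_nhdsWithin).exists
    refine ⟨s, hts, SQG.four_mul_lt_of_region hr hN0 (ht.trans (le_of_lt hts)) hs,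
      fun z hz hz0 => ⟨hz0, ?_⟩⟩
    exact (mul_le_mul_of_nonneg_left (mem_ball_zero_iff.1 hz).le hA).trans_lt hs
  have hdisc : ∀ z ∈ SQG.region SQG.radiusConst r β₀ N, ∃ s, 0 < s ∧ 4 * M * s < β₀ ∧
      z ∈ Metric.ball (0 : ℂ) s ∧
        ∀ z ∈ Metric.ball (0 : ℂ) s, z ≠ 0 → z ∈ SQG.region SQG.radiusConst r β₀ N := by
    intro z hz
    obtain ⟨s, hzs, hs, hsub⟩ := hradius ‖z‖ (norm_nonneg z) hz.2
    exact ⟨s, (norm_nonneg z).trans_lt hzs, hs, mem_ball_zero_iff.2 hzs, hsub⟩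
  obtain ⟨s₀, hs₀, hs₀M, -⟩ := hradius 0 le_rfl (by
    rw [mul_zero]; exact mul_pos SQG.radiusConst_pos hβ₀)
  have hz₀ : SQG.multiplierFlow (SQG.coeff η₀) 1 0 = η₀ := SQG.flow_zero hM0 ha hβ₀ rfl
  refine ⟨SQG.multiplierFlow (SQG.coeff η₀) 1, ⟨hz₀, ?_, ?_, ?_⟩, ?_, ?_⟩
  · have hc : ContinuousAt (SQG.multiplierFlow (SQG.coeff η₀) 1) 0 :=
      ((SQG.differentiableOn_flow_one hM0 ha hs₀ hs₀M).differentiableAt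
        (Metric.ball_mem_nhds 0 hs₀)).continuousAt
    have := hc.tendsto
    rw [hz₀] at this
    exact this.mono_left nhdsWithin_le_nhds
  · intro z hz
    obtain ⟨s, hs, hsM, hzs, -⟩ := hdisc z hz
    exact SQG.meanZero_flow hM0 ha ((SQG.meanZero_iff _).1 hη₀) hs hsM hzs
  · intro z hz
    obtain ⟨s, hs, hsM, hzs, -⟩ := hdisc z hz
    exact SQG.exists_equation_flow hM0 ha hs hsM hzs
  · rintro z (rfl | hz)
    · exact SQG.gevreyHolomorphicAt_flow (by linarith) hM0 ha hs₀ hs₀M (Metric.mem_ball_self hs₀)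
    · obtain ⟨s, hs, hsM, hzs, -⟩ := hdisc z hz
      exact SQG.gevreyHolomorphicAt_flow (by linarith) hM0 ha hs hsM hzs
  · intro η₁ h₁ z hz
    obtain ⟨s, hs, hsM, hzs, hsub⟩ := hdisc z hz
    refine SQG.eq_flow_of_equation hM0 ha hs hsM h₁.initial ?_
      (fun w hw hw0 => h₁.equation w (hsub w hw hw0)) hzs
    -- The region contains a punctured disc about 0, so attaining the initial value within the
    -- region is continuity at 0.
    rw [continuousAt_iff_punctured_nhds, h₁.initial]
    refine h₁.attained.mono_left (le_inf nhdsWithin_le_nhds ?_)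
    rw [le_principal_iff]
    filter_upwards [self_mem_nhdsWithin, nhdsWithin_le_nhds (Metric.ball_mem_nhds 0 hs)]
      with w hw hws using hsub w hws hw
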